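/- For integers $n\ge 1$ and odd $d\ge 1$, let $M=\binom{n+d}{d}$, let $T(x)\in\mathbb{R}^{M-1}$ be the vector of all monomials in $x_1,\dots,x_n$ of degree at least $1$ and at most $d$, and for $\theta\in\mathbb{R}^{M-1}$ let $p_\theta$ be the probability density on $\mathbb{R}^n$ $$p_\theta(x)=\frac{1}{Z_\theta}\exp\Big(-\sum_{i=1}^n x_i^{d+1}+\langle\theta,T(x)\rangle\Big),\qquad Z_\theta=\int_{\mathbb{R}^n}\exp\Big(-\sum_{i=1}^n x_i^{d+1}+\langle\theta,T(x)\rangle\Big)dx .$$ Let $\mathcal{I}(\theta)=\mathbb{E}_{p_\theta}[T(x)T(x)^{\mathsf T}]-\mathbb{E}_{p_\theta}[T(x)]\,\mathbb{E}_{p_\theta}[T(x)]^{\mathsf T}$ be the Fisher information matrix. For real $B\ge 1$ let $\Theta_B=\{\theta\in\mathbb{R}^{M-1}:\|\theta\|_\infty\le B\}$. Given samples $x^{(1)},\dots,x^{(N)}\in\mathbb{R}^n$, a maximum likelihood estimator $\hat\theta_{\mathrm{MLE}}$ is a measurable function of the samples that maximizes $\frac1N\sum_{k=1}^N\log p_{\theta'}(x^{(k)})$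 over all $\theta'\in\mathbb{R}^{M-1}$ whenever a maximizer exists (its value is arbitrary otherwise). Theorem. There is an absolute constant $C$ such that for all $n\ge 1$, all odd $d\ge1$, all real $B\ge 1$ and all $\theta\in\Theta_B$, writing $K=\max(2,nB)^{Cd^3}$: 1. $\lambda_{\min}(\mathcal{I}(\theta))\ge K^{-1}$. 2. If $x^{(1)},\dots,x^{(N)}$ are independent samples from $p_\theta$, then the probability that the likelihood has exactly one maximizer over $\mathbb{R}^{M-1}$ tends to $1$ as $N\to\infty$, and for every sequence of maximum likelihood estimators $\hat\theta_{\mathrm{MLE}}$ (one for each $N$), $$\sqrt N\,(\hat\theta_{\mathrm{MLE}}-\theta)\to \mathcal{N}(0,\Gamma_{\mathrm{MLE}})\ \text{ in distribution},\qquad \Gamma_{\mathrm{MLE}}=\mathcal{I}(\theta)^{-1},\qquad \|\Gamma_{\mathrm{MLE}}\|_{\mathrm{op}}\le K .$$ 3. For every such sequence and all sufficiently large $N$, with probability at least $0.99$, $\|\hat\theta_{\mathrm{MLE}}-\theta\|_2^2\le K/N$. -/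

import Mathlib

open MeasureTheory ProbabilityTheory Filter Topology

noncomputable section

namespace PolyExpFamily

/-- Multi-indices `m` of the monomials of degree between `1` and `d` in `n` variables
(each exponent of such a monomial is at most `d`). -/
abbrev MonoIdx (n d : ℕ) : Type :=
  {m : Fin n → Fin (d + 1) // 1 ≤ ∑ i, (m i : ℕ) ∧ ∑ i, (m i : ℕ) ≤ d}

/-- The parameter space, with its Euclidean norm. -/
abbrev Param (n d : ℕ) : Type := EuclideanSpace ℝ (MonoIdx n d)

variable {n d : ℕ}

/-- The sufficient statistics: the vector of all monomials of degree between `1` and `d`. -/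
def suffStat (d : ℕ) (x : Fin n → ℝ) : Param n d :=
  WithLp.toLp 2 fun m => ∏ i, x i ^ (m.1 i : ℕ)

/-- The base measure density `exp (- ∑ xᵢ ^ (d + 1))`. -/
def baseDensity (d : ℕ) (x : Fin n → ℝ) : ℝ :=
  Real.exp (-∑ i, x i ^ (d + 1))

/-- The unnormalized density. -/
def weight (θ : Param n d) (x : Fin n → ℝ) : ℝ :=
  baseDensity d x * Real.exp (inner ℝ θ (suffStat d x))

/-- The normalizing constant. -/
def partitionFn (θ : Param n d) : ℝ := ∫ x, weight θ x

/-- The density of the member of the family with parameter `θ`. -/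
def density (θ : Param n d) (x : Fin n → ℝ) : ℝ := weight θ x / partitionFn θ

/-- The distribution on `ℝⁿ` with density `density θ`. -/
def law (θ : Param n d) : Measure (Fin n → ℝ) :=
  volume.withDensity fun x => ENNReal.ofReal (density θ x)

/-- The parameters in the `ℓ∞`-ball of radius `B`. -/
def paramBall (n d : ℕ) (B : ℝ) : Set (Param n d) := {θ | ∀ m, |θ m| ≤ B}

/-- The Fisher information matrix `𝔼[T Tᵀ] - 𝔼[T] 𝔼[T]ᵀ` with respect to the
sufficient statistics `T`. -/
def fisherInfo (θ : Param n d) : Matrix (MonoIdx n d) (MonoIdx n d) ℝ :=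
  Matrix.of fun a b =>
    (∫ x, suffStat d x a * suffStat d x b ∂law θ)
      - (∫ x, suffStat d x a ∂law θ) * ∫ x, suffStat d x b ∂law θ

theorem fisherInfo_isHermitian (θ : Param n d) : (fisherInfo θ).IsHermitian := by
  ext a b
  simp [fisherInfo, mul_comm]

/-- The smallest eigenvalue of the Fisher information matrix. -/
def fisherLambdaMin (θ : Param n d) : ℝ := ⨅ i, (fisherInfo_isHermitian θ).eigenvalues i

/-- The operator norm of a square matrix with respect to the Euclidean norm. -/
def opNorm {ι : Type*} [Fintype ι] [DecidableEq ι] (A : Matrix ι ι ℝ) : ℝ :=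
  ‖Matrix.toEuclideanCLM (𝕜 := ℝ) A‖

/-- The joint distribution of `N` independent samples from `law θ`. -/
def sampleLaw (θ : Param n d) (N : ℕ) : Measure (Fin N → Fin n → ℝ) :=
  Measure.pi fun _ => law θ

/-- The average log-likelihood of the parameter `θ` on the samples `x`. -/
def logLik {N : ℕ} (x : Fin N → Fin n → ℝ) (θ : Param n d) : ℝ :=
  (∑ k, Real.log (density θ (x k))) / N

/-- `θ` is a maximum likelihood estimate for the samples `x`: it maximizes the
likelihood over the whole parameter space. -/
def IsMaxLik {N : ℕ} (x : Fin N → Fin n → ℝ) (θ : Param n d) : Prop :=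
  ∀ θ' : Param n d, logLik x θ' ≤ logLik x θ

/-- A maximum likelihood estimator for `N` samples: a measurable map which returns a
maximizer of the likelihood for all samples for which there is one (for few or degenerate
samples the supremum need not be attained; then the value is arbitrary). -/
structure IsMLE {N : ℕ} (est : (Fin N → Fin n → ℝ) → Param n d) : Prop where
  measurable : Measurable est
  isMaxLik : ∀ x, (∃ θ : Param n d, IsMaxLik x θ) → IsMaxLik x (est x)

/-! The distributions above are probability measures, since `d` is odd. -/

theorem abs_suffStat_le (x : Fin n → ℝ) (m : MonoIdx n d) :
    |suffStat d x m| ≤ 1 + ∑ i, |x i| ^ d := by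
  have hs : 0 ≤ ∑ i, |x i| ^ d := Finset.sum_nonneg fun i _ => by positivity
  simp only [suffStat, Finset.abs_prod, abs_pow]
  rcases isEmpty_or_nonempty (Fin n) with h | h
  · simp
  obtain ⟨i₀, hi₀⟩ := Finite.exists_max fun i => |x i|
  calc ∏ i, |x i| ^ (m.1 i : ℕ) ≤ ∏ i, (max 1 |x i₀|) ^ (m.1 i : ℕ) := by
        refine Finset.prod_le_prod (fun i _ => by positivity) fun i _ => ?_
        exact pow_le_pow_left₀ (abs_nonneg _) ((hi₀ i).trans (le_max_right _ _)) _
    _ = (max 1 |x i₀|) ^ (∑ i, (m.1 i : ℕ)) := Finset.prod_pow_eq_pow_sum _ _ _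
    _ ≤ (max 1 |x i₀|) ^ d := pow_le_pow_right₀ (le_max_left _ _) m.2.2
    _ ≤ 1 + |x i₀| ^ d := by
        rcases le_total 1 |x i₀| with h1 | h1
        · rw [max_eq_right h1]; linarith
        · rw [max_eq_left h1]
          simp
    _ ≤ 1 + ∑ i, |x i| ^ d := by
        gcongr
        exact Finset.single_le_sum (f := fun i => |x i| ^ d) (fun i _ => by positivity)
          (Finset.mem_univ i₀)

theorem weight_eq_exp (θ : Param n d) (x : Fin n → ℝ) :
    weight θ x = Real.exp (-(∑ i, x i ^ (d + 1)) + inner ℝ θ (suffStat d x)) := by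
  rw [weight, baseDensity, Real.exp_add]

theorem continuous_suffStat : Continuous (suffStat d : (Fin n → ℝ) → Param n d) := by
  unfold suffStat
  fun_prop

theorem continuous_weight (θ : Param n d) : Continuous (weight θ) := by
  have := continuous_suffStat (n := n) (d := d)
  unfold weight baseDensity
  fun_prop

theorem integrable_weight [hd : Fact (Odd d)] (θ : Param n d) : Integrable (weight θ) := by
  set S : ℝ := ∑ m, |θ m| with hS
  have hS0 : 0 ≤ S := Finset.sum_nonneg fun i _ => abs_nonneg _
  have h1 : ∀ t : ℝ, 0 ≤ t → S * t ^ d - t ^ (d + 1) ≤ S * (S + 1) ^ d + (S + 1) - t := by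
    intro t ht
    rcases le_total t (S + 1) with h | h
    · have h2 : S * t ^ d ≤ S * (S + 1) ^ d := by gcongr
      have h3 : 0 ≤ t ^ (d + 1) := by positivity
      linarith
    · have ht1 : 1 ≤ t := by linarith
      have h2 : (S + 1) * t ^ d ≤ t ^ (d + 1) := by
        rw [pow_succ, mul_comm]; gcongr
      have h3 : t ≤ t ^ d := le_self_pow₀ ht1 hd.out.pos.ne'
      have h4 : 0 ≤ S * (S + 1) ^ d := by positivity
      linarith
  have hint : Integrable fun t : ℝ => Real.exp (S * (S + 1) ^ d + (S + 1) - |t|) := by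
    have h2 : Integrable fun t : ℝ => Real.exp (-|t|) := by
      rw [← integrableOn_univ, ← Set.Iic_union_Ioi (a := (0 : ℝ)), integrableOn_union]
      constructor
      · refine (integrableOn_exp_Iic 0).congr_fun (fun t ht => ?_) measurableSet_Iic
        simp [abs_of_nonpos (Set.mem_Iic.1 ht)]
      · refine (integrableOn_exp_neg_Ioi 0).congr_fun (fun t ht => ?_) measurableSet_Ioi
        simp [abs_of_pos (Set.mem_Ioi.1 ht)]
    convert h2.const_mul (Real.exp (S * (S + 1) ^ d + (S + 1))) using 2 with t
    rw [← Real.exp_add]; ring_nf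
  have hprod : Integrable fun x : Fin n → ℝ =>
      ∏ i, Real.exp (S * (S + 1) ^ d + (S + 1) - |x i|) :=
    Integrable.fintype_prod (f := fun _ t => Real.exp (S * (S + 1) ^ d + (S + 1) - |t|))
      fun _ => hint
  refine (hprod.const_mul (Real.exp S)).mono' (continuous_weight θ).aestronglyMeasurable
    (ae_of_all _ fun x => ?_)
  rw [weight_eq_exp, Real.norm_eq_abs, Real.abs_exp, ← Real.exp_sum, ← Real.exp_add]
  refine Real.exp_le_exp.2 ?_
  have h2 : inner ℝ θ (suffStat d x) ≤ S * (1 + ∑ i, |x i| ^ d) := by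
    rw [PiLp.inner_apply, hS, Finset.sum_mul]
    refine Finset.sum_le_sum fun m _ => ?_
    refine (le_abs_self _).trans ?_
    rw [RCLike.inner_apply, abs_mul, mul_comm]
    simp only [conj_trivial]
    gcongr
    exact abs_suffStat_le x m
  have h3 : ∀ i, x i ^ (d + 1) = |x i| ^ (d + 1) := fun i =>
    ((Odd.add_one hd.out).pow_abs _).symm
  have h4 : ∑ i, (S * |x i| ^ d - |x i| ^ (d + 1))
      ≤ ∑ i, (S * (S + 1) ^ d + (S + 1) - |x i|) :=
    Finset.sum_le_sum fun i _ => h1 _ (abs_nonneg _)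
  simp only [h3]
  rw [Finset.sum_sub_distrib, ← Finset.mul_sum] at h4
  linarith

instance isProbabilityMeasure_law [Fact (Odd d)] (θ : Param n d) :
    IsProbabilityMeasure (law θ) := by
  have h := isProbabilityMeasure_tilted (μ := (volume : Measure (Fin n → ℝ)))
    (f := fun x => -(∑ i, x i ^ (d + 1)) + inner ℝ θ (suffStat d x))
    (by simpa only [← weight_eq_exp] using integrable_weight θ)
  simp only [Measure.tilted, ← weight_eq_exp] at h
  exact h

instance isProbabilityMeasure_sampleLaw [Fact (Odd d)] (θ : Param n d) (N : ℕ) :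
    IsProbabilityMeasure (sampleLaw θ N) := by
  unfold sampleLaw
  infer_instance

end PolyExpFamily

end

/-!
Write `b = max 2 (n * B)` (`scaleParam n B`), `T` for the sufficient statistics, and
`V = ∑ xᵢ ^ (d + 1) - ⟨θ, T⟩` for the negative logarithm of the weight.

**Conditioning.** The quadratic form of the Fisher information at `v` is the second moment of the
polynomial `g = ⟨v, T⟩ - c` with `c = 𝔼 ⟨v, T⟩`, and it is bounded below by testing `g` with finite
differences. Let `Q` be the cube of radius `R = b ^ O(d)`. It carries at least half of the mass:
outside of it `V x - V (x / 2) ≥ n + 1`, hence `weight θ (x / 2) ≥ 2 ^ (n + 1) * weight θ x`, while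
the integral of `weight θ (x / 2)` is only `2 ^ n` times the partition function
(`half_partitionFn_le`). On `Q`, a translation by at most `b ^ (-O(d ^ 2))` changes the weight by a
bounded factor (`weight_le_four_mul`), so the integral of `g (x + s) ^ 2` over `Q` is controlled
by the second moment of `g` for every such `s`, hence so is that of the square of every
finite difference of `g` with a step of this size. Some difference is large at every point of `Q`
(`exists_mixedDiff_sq_ge`): the difference of order `m` annihilates all monomials that are not
divisible by the monomial `m`, and if `m` maximizes `|v m| * A ^ (degree of m)` for a large `A`, the
term of `m` dominates the remaining ones. At most `d` coordinates are shifted, so the number of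
nodes is bounded in terms of `d` alone, and the loss is `(R / step) ^ O(d) = b ^ O(d ^ 3)`
(`norm_sq_le_scaleParam_pow_mul_integral_sq`).

**Maximum likelihood.** Up to an additive constant, the log-likelihood of `θ + h` is `-log G h`,
where `G h = 𝔼 exp ⟨h, T - 𝔼 T - w⟩` and `w` is the deviation of the empirical mean of `T`
(`logLik_add`). The function `G` is convex, and it has at most one minimizer because the Fisher
information is positive definite (`minimizer_unique`). To second order, `log G` is the quadratic
`⟨h, I h⟩ / 2 - ⟨h, w⟩` (`log_laplace_sub_quadratic_isLittleO`), where `I` is the Fisher information.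
If the score `√N • w` is bounded and `N` is large, `G` is therefore larger on a sphere of radius
`ρ / √N` around `I⁻¹ w` than at its centre, and by convexity a minimizer exists and all minimizers
lie in the ball (`exists_minimizer_and_norm_sub_le`, `eventually_existsUnique_isMaxLik`). The
central limit theorem for the score (`tendstoInDistribution_fisherOpInv_score`), obtained from the
one-dimensional one through characteristic functions, then yields the limit law of the estimator.
The risk bound follows from the portmanteau theorem and the second moment `trace I⁻¹` of the limit.
-/

noncomputable section

namespace PolyExpFamily

variable {n d : ℕ}

/-! ### Iterated forward differences of powers -/

/-- The discrete Leibniz rule for the product of a function with the identity. -/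
theorem fwdDiff_iter_succ_id_mul (ε : ℝ) (f : ℝ → ℝ) (k : ℕ) (t : ℝ) :
    (fwdDiff ε)^[k + 1] (fun s => s * f s) t =
      t * (fwdDiff ε)^[k + 1] f t + (k + 1) * ε * (fwdDiff ε)^[k] f (t + ε) := by
  induction k generalizing t with
  | zero => simp [fwdDiff]; ring
  | succ k ih =>
    rw [Function.iterate_succ_apply', fwdDiff, ih, ih,
      Function.iterate_succ_apply' (fwdDiff ε) (k + 1) f]
    have h := fun s => congrFun (Function.iterate_succ_apply' (fwdDiff ε) k f) s
    simp only [fwdDiff] at h ⊢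
    push_cast
    rw [h (t + ε), h t]
    ring

theorem abs_fwdDiff_iter_pow_le {ε ρ : ℝ} (hε : 0 ≤ ε) (l k : ℕ) (t : ℝ)
    (ht : |t| + k * ε ≤ ρ) :
    |(fwdDiff ε)^[k] (fun s => s ^ l) t| ≤ ε ^ k * l.descFactorial k * ρ ^ (l - k) := by
  induction l generalizing k t with
  | zero =>
    cases k with
    | zero => simp
    | succ k =>
      have : (fwdDiff ε)^[k + 1] (fun _ : ℝ => (1 : ℝ)) t = 0 := by
        rw [Function.iterate_succ_apply]
        have h0 : fwdDiff ε (fun _ : ℝ => (1 : ℝ)) = 0 := by ext; simp [fwdDiff]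
        rw [h0]
        have : ∀ k, (fwdDiff ε)^[k] (0 : ℝ → ℝ) = 0 := fun k =>
          Function.iterate_fixed (by ext; simp [fwdDiff]) k
        simp [this]
      simp [this]
  | succ l ih =>
    have hρ : |t| ≤ ρ := le_trans (by simp; positivity) ht
    have hρ0 : 0 ≤ ρ := (abs_nonneg _).trans hρ
    cases k with
    | zero =>
      simp only [Function.iterate_zero, id_eq, pow_zero, Nat.descFactorial_zero, Nat.cast_one,
        one_mul, Nat.sub_zero, abs_pow]
      gcongr
    | succ k =>
      have e : (fun s : ℝ => s ^ (l + 1)) = fun s => s * s ^ l := by ext; ring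
      rw [e, fwdDiff_iter_succ_id_mul]
      have h1 := ih (k + 1) t ht
      have h2 := ih k (t + ε) (by
        have := abs_add_le t ε
        rw [abs_of_nonneg hε] at this
        push_cast at ht
        linarith)
      have h3 : |t| * (ε ^ (k + 1) * l.descFactorial (k + 1) * ρ ^ (l - (k + 1))) ≤
          ε ^ (k + 1) * l.descFactorial (k + 1) * ρ ^ (l - k) := by
        rcases Nat.lt_or_ge l (k + 1) with h | h
        · rw [Nat.descFactorial_eq_zero_iff_lt.2 h]; simp
        · rw [show l - k = (l - (k + 1)) + 1 by omega, pow_succ ρ]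
          calc _ ≤ ρ * (ε ^ (k + 1) * l.descFactorial (k + 1) * ρ ^ (l - (k + 1))) := by gcongr
            _ = _ := by ring
      have h4 : ((l + 1).descFactorial (k + 1) : ℝ)
          = l.descFactorial (k + 1) + (k + 1) * l.descFactorial k := by
        rcases Nat.lt_or_ge l k with h | h
        · rw [Nat.descFactorial_eq_zero_iff_lt.2 h,
            Nat.descFactorial_eq_zero_iff_lt.2 (show l < k + 1 by omega),
            Nat.descFactorial_eq_zero_iff_lt.2 (show l + 1 < k + 1 by omega)]
          simp
        · rw [Nat.succ_descFactorial_succ, Nat.descFactorial_succ]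
          push_cast [h]
          ring
      calc _ ≤ |t * (fwdDiff ε)^[k + 1] (fun s => s ^ l) t| +
            |(k + 1) * ε * (fwdDiff ε)^[k] (fun s => s ^ l) (t + ε)| := abs_add_le _ _
        _ = |t| * |(fwdDiff ε)^[k + 1] (fun s => s ^ l) t| +
            (k + 1) * ε * |(fwdDiff ε)^[k] (fun s => s ^ l) (t + ε)| := by
            rw [abs_mul, abs_mul, abs_of_nonneg (show 0 ≤ ((k : ℝ) + 1) * ε by positivity)]
        _ ≤ |t| * (ε ^ (k + 1) * l.descFactorial (k + 1) * ρ ^ (l - (k + 1))) +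
            (k + 1) * ε * (ε ^ k * l.descFactorial k * ρ ^ (l - k)) := by gcongr
        _ ≤ ε ^ (k + 1) * l.descFactorial (k + 1) * ρ ^ (l - k) +
            (k + 1) * ε * (ε ^ k * l.descFactorial k * ρ ^ (l - k)) := by gcongr
        _ = _ := by
            rw [h4, Nat.add_sub_add_right]; ring

theorem fwdDiff_iter_pow_eq_zero {ε : ℝ} (hε : 0 ≤ ε) {l k : ℕ} (h : l < k) (t : ℝ) :
    (fwdDiff ε)^[k] (fun s => s ^ l) t = 0 := by
  have := abs_fwdDiff_iter_pow_le hε l k t le_rfl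
  rw [Nat.descFactorial_eq_zero_iff_lt.2 h] at this
  simpa using this

theorem fwdDiff_iter_pow_self {ε : ℝ} (hε : 0 ≤ ε) (k : ℕ) (t : ℝ) :
    (fwdDiff ε)^[k] (fun s => s ^ k) t = k.factorial * ε ^ k := by
  induction k generalizing t with
  | zero => simp
  | succ k ih =>
    have e : (fun s : ℝ => s ^ (k + 1)) = fun s => s * s ^ k := by ext; ring
    rw [e, fwdDiff_iter_succ_id_mul, ih, fwdDiff_iter_pow_eq_zero hε (Nat.lt_succ_self k),
      Nat.factorial_succ]
    push_cast
    ring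

/-! ### Mixed finite differences of polynomials -/

/-- The coefficients of the mixed finite difference of order `m`. -/
def diffCoeff (m j : Fin n → ℕ) : ℝ := ∏ i, ((-1) ^ (m i - j i) * ((m i).choose (j i) : ℝ))

/-- The evaluation points of the mixed finite difference of order `m`, in units of the step. -/
def diffNodes (m : Fin n → ℕ) : Finset (Fin n → ℕ) :=
  Fintype.piFinset fun i => Finset.range (m i + 1)

/-- The mixed finite difference of order `m` and step `ε`: the forward difference in the `i`-th
coordinate is iterated `m i` times. -/
def mixedDiff (ε : ℝ) (m : Fin n → ℕ) (g : (Fin n → ℝ) → ℝ) (x : Fin n → ℝ) : ℝ :=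
  ∑ j ∈ diffNodes m, diffCoeff m j * g (x + fun i => ε * j i)

/-- On monomials, mixed differences factor over the coordinates. -/
theorem mixedDiff_prod_pow (ε : ℝ) (m l : Fin n → ℕ) (x : Fin n → ℝ) :
    mixedDiff ε m (fun y => ∏ i, y i ^ l i) x =
      ∏ i, (fwdDiff ε)^[m i] (fun s => s ^ l i) (x i) := by
  simp only [fwdDiff_iter_eq_sum_shift, Finset.prod_univ_sum, mixedDiff, diffNodes, diffCoeff,
    ← Finset.prod_mul_distrib]
  refine Finset.sum_congr rfl fun j _ => Finset.prod_congr rfl fun i _ => ?_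
  simp [mul_comm ε]

theorem sum_abs_diffCoeff (m : Fin n → ℕ) :
    ∑ j ∈ diffNodes m, |diffCoeff m j| = 2 ^ ∑ i, m i := by
  simp only [diffNodes, diffCoeff, Finset.abs_prod, abs_mul, abs_pow, abs_neg, abs_one, one_pow,
    one_mul, Nat.abs_cast]
  rw [← Finset.prod_univ_sum (fun i => Finset.range (m i + 1))
    (fun i j => ((m i).choose j : ℝ)), ← Finset.prod_pow_eq_pow_sum]
  refine Finset.prod_congr rfl fun i _ => ?_
  exact_mod_cast Nat.sum_range_choose (m i)

theorem sq_mixedDiff_le (ε : ℝ) (m : Fin n → ℕ) (g : (Fin n → ℝ) → ℝ) (x : Fin n → ℝ) :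
    mixedDiff ε m g x ^ 2 ≤
      2 ^ (∑ i, m i) * ∑ j ∈ diffNodes m, |diffCoeff m j| * g (x + fun i => ε * j i) ^ 2 := by
  rw [← sum_abs_diffCoeff, mixedDiff]
  refine Finset.sum_sq_le_sum_mul_sum_of_sq_le_mul _ (fun _ _ => abs_nonneg _)
    (fun _ _ => by positivity) fun j _ => ?_
  rw [mul_pow, ← mul_assoc, abs_mul_abs_self, sq (diffCoeff m j)]

/-- The total degree of a monomial. -/
def MonoIdx.degree (m : MonoIdx n d) : ℕ := ∑ i, (m.1 i : ℕ)

theorem MonoIdx.degree_le (m : MonoIdx n d) : m.degree ≤ d := m.2.2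

theorem MonoIdx.one_le_degree (m : MonoIdx n d) : 1 ≤ m.degree := m.2.1

/-- The exponents of a monomial as natural numbers. -/
def MonoIdx.expo (m : MonoIdx n d) (i : Fin n) : ℕ := m.1 i

/-- A mixed difference of order `m` annihilates every other monomial, unless `m` divides it
properly. -/
theorem abs_mixedDiff_suffStat_le {ε ρ : ℝ} (hε : 0 ≤ ε) (m m' : MonoIdx n d) (hne : m' ≠ m)
    (x : Fin n → ℝ) (hx : ‖x‖ + d * ε ≤ ρ) :
    mixedDiff ε m.expo (fun y => suffStat d y m') x = 0 ∨ (m.degree < m'.degree ∧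
      |mixedDiff ε m.expo (fun y => suffStat d y m') x| ≤
        ε ^ m.degree * d ^ d * ρ ^ (m'.degree - m.degree)) := by
  have e := mixedDiff_prod_pow ε m.expo m'.expo x
  change mixedDiff ε m.expo (fun y => suffStat d y m') x = _ at e
  rw [e]
  by_cases h : ∃ i, m'.expo i < m.expo i
  · obtain ⟨i, hi⟩ := h
    exact Or.inl (Finset.prod_eq_zero (Finset.mem_univ i) (fwdDiff_iter_pow_eq_zero hε hi _))
  right
  push Not at h
  have hdeg : m'.degree - m.degree = ∑ i, (m'.expo i - m.expo i) := by
    rw [Finset.sum_tsub_distrib _ fun i _ => h i]; rfl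
  refine ⟨?_, ?_⟩
  · refine Finset.sum_lt_sum (fun i _ => h i) ?_
    by_contra! hcon
    refine hne (Subtype.ext (funext fun i => Fin.ext ?_))
    exact le_antisymm (hcon i (Finset.mem_univ i)) (h i)
  · have hd1 : 1 ≤ d := m.one_le_degree.trans m.degree_le
    have hxi : ∀ i, |x i| + m.expo i * ε ≤ ρ := fun i => by
      have h1 : |x i| ≤ ‖x‖ := norm_le_pi_norm x i
      have h2 : (m.expo i : ℝ) ≤ d := by exact_mod_cast Fin.is_le (m.1 i)
      have h3 : (m.expo i : ℝ) * ε ≤ d * ε := by gcongr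
      linarith
    rw [Finset.abs_prod, hdeg]
    have hρ : ∀ i, (0 : ℝ) ≤ ρ := fun i => le_trans (by positivity) (hxi i)
    calc _ ≤ ∏ i, (ε ^ m.expo i * (d : ℝ) ^ m.expo i * ρ ^ (m'.expo i - m.expo i)) := by
          refine Finset.prod_le_prod (fun _ _ => abs_nonneg _) fun i _ => ?_
          refine (abs_fwdDiff_iter_pow_le hε _ _ _ (hxi i)).trans ?_
          have h1 : ((m'.expo i).descFactorial (m.expo i) : ℝ) ≤ (d : ℝ) ^ m.expo i := by
            have h2 : m'.expo i ≤ d := Fin.is_le (m'.1 i)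
            calc ((m'.expo i).descFactorial (m.expo i) : ℝ) ≤ ((m'.expo i ^ m.expo i : ℕ) : ℝ) := by
                  exact_mod_cast Nat.descFactorial_le_pow _ _
              _ ≤ _ := by push_cast; gcongr
          have := hρ i
          gcongr
      _ = ε ^ m.degree * d ^ m.degree * ρ ^ (∑ i, (m'.expo i - m.expo i)) := by
          simp only [Finset.prod_mul_distrib, Finset.prod_pow_eq_pow_sum]; rfl
      _ ≤ _ := by
          have : (0 : ℝ) ≤ ρ ^ (∑ i, (m'.expo i - m.expo i)) := by
            rcases isEmpty_or_nonempty (Fin n) with h0 | ⟨⟨i⟩⟩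
            · simp
            · have := hρ i; positivity
          have hd1' : (1 : ℝ) ≤ d := by exact_mod_cast hd1
          gcongr
          exact m.degree_le

theorem mixedDiff_suffStat_self {ε : ℝ} (hε : 0 ≤ ε) (m : MonoIdx n d) (x : Fin n → ℝ) :
    ε ^ m.degree ≤ mixedDiff ε m.expo (fun y => suffStat d y m) x := by
  have e := mixedDiff_prod_pow ε m.expo m.expo x
  change mixedDiff ε m.expo (fun y => suffStat d y m) x = _ at e
  rw [e]
  simp only [fwdDiff_iter_pow_self hε, Finset.prod_mul_distrib, Finset.prod_pow_eq_pow_sum]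
  change _ ≤ _ * ε ^ m.degree
  refine le_mul_of_one_le_left (by positivity) ?_
  exact_mod_cast Finset.prod_pos fun i _ => Nat.factorial_pos _

theorem mixedDiff_const (ε c : ℝ) (hε : 0 ≤ ε) (m : MonoIdx n d) (x : Fin n → ℝ) :
    mixedDiff ε m.expo (fun _ => c) x = 0 := by
  have e := mixedDiff_prod_pow ε m.expo (fun _ => 0) x
  obtain ⟨i, -, hi⟩ : ∃ i ∈ Finset.univ, 0 ≠ m.expo i := by
    by_contra! h
    have h0 : m.degree = 0 := Finset.sum_eq_zero fun i hi => (h i hi).symm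
    have := m.one_le_degree
    omega
  rw [Finset.prod_eq_zero (Finset.mem_univ i)
    (fwdDiff_iter_pow_eq_zero hε (Nat.pos_of_ne_zero hi.symm) _)] at e
  simp only [mixedDiff, pow_zero, Finset.prod_const_one, mul_one] at e ⊢
  rw [← Finset.sum_mul, e, zero_mul]

theorem mixedDiff_inner_sub_const (ε c : ℝ) (hε : 0 ≤ ε) (m : MonoIdx n d) (v : Param n d)
    (x : Fin n → ℝ) :
    mixedDiff ε m.expo (fun y => inner ℝ v (suffStat d y) - c) x =
      ∑ m', v m' * mixedDiff ε m.expo (fun y => suffStat d y m') x := by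
  have h := mixedDiff_const ε c hε m x
  have e : mixedDiff ε m.expo (fun y => inner ℝ v (suffStat d y) - c) x =
      mixedDiff ε m.expo (fun y => inner ℝ v (suffStat d y)) x -
        mixedDiff ε m.expo (fun _ => c) x := by
    simp only [mixedDiff, mul_sub, Finset.sum_sub_distrib]
  rw [e, h, sub_zero]
  simp only [mixedDiff, PiLp.inner_apply, Finset.mul_sum]
  rw [Finset.sum_comm]
  refine Finset.sum_congr rfl fun j _ => Finset.sum_congr rfl fun m' _ => ?_
  simp
  ring

/-- Some mixed difference of a non-constant polynomial stays away from zero on a large cube. The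
order `m` is the monomial that maximizes `|v m| * A ^ m.degree`: for large `A`, the contributions
of the monomials of higher degree are then dominated by that of `m`. -/
theorem exists_mixedDiff_sq_ge [Nonempty (MonoIdx n d)] {ε ρ A : ℝ} (hε : 0 ≤ ε) (hε1 : ε ≤ 1)
    (hρ : 1 ≤ ρ) (hA : 2 * Fintype.card (MonoIdx n d) * d ^ d * ρ ≤ A) (v : Param n d) :
    ∃ m : MonoIdx n d, ∀ (c : ℝ) (x : Fin n → ℝ), ‖x‖ + d * ε ≤ ρ →
      ε ^ (2 * d) * ‖v‖ ^ 2 ≤ 4 * Fintype.card (MonoIdx n d) * A ^ (2 * d) *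
        mixedDiff ε m.expo (fun y => inner ℝ v (suffStat d y) - c) x ^ 2 := by
  obtain ⟨m, hm⟩ := Finite.exists_max fun m : MonoIdx n d => |v m| * A ^ m.degree
  refine ⟨m, fun c x hx => ?_⟩
  have hd1 : 1 ≤ d := m.one_le_degree.trans m.degree_le
  have hd1' : (1 : ℝ) ≤ d := by exact_mod_cast hd1
  set M : ℝ := ((Fintype.card (MonoIdx n d) : ℕ) : ℝ) with hM
  have hM1 : (1 : ℝ) ≤ M := by
    rw [hM]; exact_mod_cast Fintype.card_pos
  have hdd : (1 : ℝ) ≤ (d : ℝ) ^ d := one_le_pow₀ hd1'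
  set H : ℝ := 2 * M * d ^ d with hH
  have hH1 : 1 ≤ H := by nlinarith
  have hHA : H * ρ ≤ A := hA
  have hρ0 : 0 < ρ := by linarith
  have hA1 : 1 ≤ A := by nlinarith
  -- the coefficient of the selected monomial controls the norm
  have hv : ‖v‖ ^ 2 ≤ M * (A ^ (2 * d) * v m ^ 2) := by
    rw [EuclideanSpace.real_norm_sq_eq]
    calc ∑ i, v i ^ 2 ≤ ∑ _i : MonoIdx n d, A ^ (2 * d) * v m ^ 2 := by
          refine Finset.sum_le_sum fun i _ => ?_
          have h1 : |v i| ≤ |v m| * A ^ d := by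
            calc |v i| ≤ |v i| * A ^ i.degree := le_mul_of_one_le_right (abs_nonneg _)
                  (one_le_pow₀ hA1)
              _ ≤ |v m| * A ^ m.degree := hm i
              _ ≤ _ := by gcongr; exact m.degree_le
          calc v i ^ 2 = |v i| ^ 2 := (sq_abs _).symm
            _ ≤ (|v m| * A ^ d) ^ 2 := by gcongr
            _ = _ := by rw [mul_pow, sq_abs, ← pow_mul, mul_comm d 2, mul_comm]
      _ = _ := by simp [hM]
  -- the leading term `ε ^ m.degree * |v m|` is at least twice the sum of the other terms
  have hDlow : ε ^ d * |v m| / 2 ≤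
      |mixedDiff ε m.expo (fun y => inner ℝ v (suffStat d y) - c) x| := by
    rw [mixedDiff_inner_sub_const ε c hε, ← Finset.add_sum_erase _ _ (Finset.mem_univ m)]
    have hrest : |∑ m' ∈ Finset.univ.erase m,
        v m' * mixedDiff ε m.expo (fun y => suffStat d y m') x| ≤
          ε ^ m.degree * |v m| / 2 := by
      have hterm : ∀ m' ∈ Finset.univ.erase m,
          |v m' * mixedDiff ε m.expo (fun y => suffStat d y m') x| ≤
            ε ^ m.degree * |v m| / (2 * M) := by
        intro m' hm'
        rcases abs_mixedDiff_suffStat_le hε m m' (Finset.ne_of_mem_erase hm') x hx with h | h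
        · rw [h]; simp; positivity
        obtain ⟨h1, h2⟩ := h
        obtain ⟨k, hk⟩ : ∃ k, m'.degree = m.degree + (k + 1) := ⟨m'.degree - m.degree - 1, by omega⟩
        -- by maximality of `m`, the coefficient decays geometrically in the excess degree
        have h3 : |v m'| * A ^ (k + 1) ≤ |v m| := by
          have := hm m'
          simp only [hk] at this
          rw [pow_add, mul_left_comm, mul_comm |v m|] at this
          exact le_of_mul_le_mul_left this (by positivity)
        have h4 : |v m'| * ρ ^ (k + 1) * H ≤ |v m| := by
          refine le_trans ?_ h3
          calc |v m'| * ρ ^ (k + 1) * H ≤ |v m'| * ρ ^ (k + 1) * H ^ (k + 1) := by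
                gcongr; exact le_self_pow₀ hH1 (by omega)
            _ = |v m'| * (H * ρ) ^ (k + 1) := by rw [mul_pow]; ring
            _ ≤ _ := by gcongr
        rw [hk, Nat.add_sub_cancel_left] at h2
        rw [abs_mul, le_div_iff₀ (by positivity)]
        calc _ ≤ |v m'| * (ε ^ m.degree * d ^ d * ρ ^ (k + 1)) * (2 * M) := by gcongr
          _ = ε ^ m.degree * (|v m'| * ρ ^ (k + 1) * H) := by rw [hH]; ring
          _ ≤ _ := by gcongr
      refine (Finset.abs_sum_le_sum_abs _ _).trans ?_
      calc _ ≤ ∑ _m' ∈ Finset.univ.erase m, ε ^ m.degree * |v m| / (2 * M) :=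
            Finset.sum_le_sum hterm
        _ ≤ ∑ _m' : MonoIdx n d, ε ^ m.degree * |v m| / (2 * M) :=
            Finset.sum_le_sum_of_subset_of_nonneg (Finset.erase_subset _ _)
              fun _ _ _ => by positivity
        _ = _ := by
            rw [Finset.sum_const, Finset.card_univ, nsmul_eq_mul, ← hM]
            field_simp
    have hmain : ε ^ m.degree * |v m| ≤
        |v m * mixedDiff ε m.expo (fun y => suffStat d y m) x| := by
      rw [abs_mul, mul_comm]
      gcongr
      exact (mixedDiff_suffStat_self hε m x).trans (le_abs_self _)
    have hεd : ε ^ d * |v m| ≤ ε ^ m.degree * |v m| := by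
      gcongr ?_ * _
      exact pow_le_pow_of_le_one hε hε1 m.degree_le
    have htri := abs_sub_abs_le_abs_sub
      (v m * mixedDiff ε m.expo (fun y => suffStat d y m) x)
      (-∑ m' ∈ Finset.univ.erase m, v m' * mixedDiff ε m.expo (fun y => suffStat d y m') x)
    rw [abs_neg, sub_neg_eq_add] at htri
    linarith
  have hsq : (ε ^ d * |v m| / 2) ^ 2 ≤
      mixedDiff ε m.expo (fun y => inner ℝ v (suffStat d y) - c) x ^ 2 := by
    rw [← sq_abs (mixedDiff _ _ _ _)]
    gcongr
  calc ε ^ (2 * d) * ‖v‖ ^ 2 ≤ ε ^ (2 * d) * (M * (A ^ (2 * d) * v m ^ 2)) := by gcongr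
    _ = 4 * M * A ^ (2 * d) * (ε ^ d * |v m| / 2) ^ 2 := by
        rw [div_pow, mul_pow, sq_abs, ← pow_mul, mul_comm d 2]; ring
    _ ≤ _ := by gcongr

/-! ### Integration against the laws of the family -/

theorem weight_pos (θ : Param n d) (x : Fin n → ℝ) : 0 < weight θ x := by
  rw [weight_eq_exp]; exact Real.exp_pos _

theorem weight_add (θ h : Param n d) (x : Fin n → ℝ) :
    weight (θ + h) x = Real.exp (inner ℝ h (suffStat d x)) * weight θ x := by
  rw [weight, weight, inner_add_left, Real.exp_add]
  ring

theorem partitionFn_pos [Fact (Odd d)] (θ : Param n d) : 0 < partitionFn θ := by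
  have h := integrable_weight θ
  simp only [partitionFn, weight_eq_exp, funext (weight_eq_exp θ)] at h ⊢
  exact integral_exp_pos h

theorem continuous_density (θ : Param n d) : Continuous (density θ) :=
  (continuous_weight θ).div_const _

theorem integral_law [Fact (Odd d)] (θ : Param n d) (f : (Fin n → ℝ) → ℝ) :
    ∫ x, f x ∂law θ = (∫ x, f x * weight θ x) / partitionFn θ := by
  rw [law, integral_withDensity_eq_integral_toReal_smul
    (continuous_density θ).measurable.ennreal_ofReal (by simp), ← integral_div]
  refine integral_congr_ae (ae_of_all _ fun x => ?_)
  have h : 0 ≤ density θ x := (div_pos (weight_pos θ x) (partitionFn_pos θ)).le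
  beta_reduce
  rw [ENNReal.toReal_ofReal h, smul_eq_mul, density]
  ring

theorem integrable_law_iff [Fact (Odd d)] (θ : Param n d) (f : (Fin n → ℝ) → ℝ) :
    Integrable f (law θ) ↔ Integrable fun x => f x * weight θ x := by
  rw [law, integrable_withDensity_iff_integrable_smul'
    (continuous_density θ).measurable.ennreal_ofReal (by simp)]
  have hZ := partitionFn_pos θ
  have e : (fun x => (ENNReal.ofReal (density θ x)).toReal • f x) =
      fun x => (partitionFn θ)⁻¹ * (f x * weight θ x) := by
    ext x
    have h : 0 ≤ density θ x := (div_pos (weight_pos θ x) hZ).le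
    rw [ENNReal.toReal_ofReal h, smul_eq_mul, density]
    ring
  rw [e, integrable_const_mul_iff (IsUnit.mk0 _ (inv_ne_zero hZ.ne'))]

/-- The sufficient statistics have exponential moments of all orders. -/
theorem integrable_exp_norm_suffStat [Fact (Odd d)] (θ : Param n d) (c : ℝ) :
    Integrable (fun x => Real.exp (c * ‖suffStat d x‖)) (law θ) := by
  rw [integrable_law_iff]
  have hcont := continuous_suffStat (n := n) (d := d)
  rcases isEmpty_or_nonempty (MonoIdx n d) with h0 | h0
  · have h (x : Fin n → ℝ) : suffStat d x = 0 := Subsingleton.elim _ _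
    simpa [h] using integrable_weight θ
  set M : ℝ := ((Fintype.card (MonoIdx n d) : ℕ) : ℝ) with hM
  set a : ℝ := |c| * M with ha
  -- up to the factor `M`, the norm is the largest coordinate, and exponentials of a single
  -- coordinate are absorbed by a change of parameter
  have hint : Integrable fun x => ∑ m : MonoIdx n d,
      (weight (θ + EuclideanSpace.single m a) x + weight (θ + EuclideanSpace.single m (-a)) x) :=
    integrable_finsetSum _ fun m _ => (integrable_weight _).add (integrable_weight _)
  refine hint.mono' (by
    have := continuous_weight θ
    exact Continuous.aestronglyMeasurable (by fun_prop)) (ae_of_all _ fun x => ?_)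
  obtain ⟨m, hm⟩ := Finite.exists_max fun m : MonoIdx n d => |suffStat d x m|
  have hM1 : (1 : ℝ) ≤ M := by rw [hM]; exact_mod_cast Fintype.card_pos
  have hnorm : ‖suffStat d x‖ ≤ M * |suffStat d x m| := by
    rw [← pow_le_pow_iff_left₀ (norm_nonneg _) (by positivity) two_ne_zero,
      EuclideanSpace.real_norm_sq_eq]
    calc ∑ i, suffStat d x i ^ 2 ≤ ∑ _i : MonoIdx n d, |suffStat d x m| ^ 2 := by
          refine Finset.sum_le_sum fun i _ => ?_
          rw [← sq_abs]; exact pow_le_pow_left₀ (abs_nonneg _) (hm i) 2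
      _ = M * |suffStat d x m| ^ 2 := by simp [hM]
      _ ≤ M ^ 2 * |suffStat d x m| ^ 2 := by gcongr; exact le_self_pow₀ hM1 two_ne_zero
      _ = _ := by ring
  have hw := (weight_pos θ x).le
  have h1 : Real.exp (c * ‖suffStat d x‖) ≤
      Real.exp (a * suffStat d x m) + Real.exp (-a * suffStat d x m) := by
    have h2 : c * ‖suffStat d x‖ ≤ a * |suffStat d x m| := by
      calc c * ‖suffStat d x‖ ≤ |c| * (M * |suffStat d x m|) := by
            gcongr; exact le_abs_self c
        _ = _ := by rw [ha]; ring
    refine (Real.exp_le_exp.2 h2).trans ?_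
    rcases abs_cases (suffStat d x m) with h | h <;> rw [h.1]
    · linarith [Real.exp_pos (-a * suffStat d x m)]
    · rw [neg_mul, mul_neg]
      linarith [Real.exp_pos (a * suffStat d x m)]
  rw [Real.norm_eq_abs, abs_of_nonneg (by positivity)]
  calc Real.exp (c * ‖suffStat d x‖) * weight θ x
      ≤ (Real.exp (a * suffStat d x m) + Real.exp (-a * suffStat d x m)) * weight θ x := by
        gcongr
    _ = weight (θ + EuclideanSpace.single m a) x +
          weight (θ + EuclideanSpace.single m (-a)) x := by
        rw [weight_add, weight_add, EuclideanSpace.inner_single_left,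
          EuclideanSpace.inner_single_left]
        simp only [conj_trivial]
        ring
    _ ≤ _ := Finset.single_le_sum
        (f := fun m => weight (θ + EuclideanSpace.single m a) x +
          weight (θ + EuclideanSpace.single m (-a)) x)
        (fun m _ => add_nonneg (weight_pos _ _).le (weight_pos _ _).le) (Finset.mem_univ m)

/-! ### The number of monomials -/

/-- The number of monomials is at most `2 (2n)ᵈ`: give each monomial of degree `k` the weight
`(2n)⁻ᵏ` and compare with a product of geometric sums. -/
theorem card_monoIdx_le (hn : 1 ≤ n) : (Fintype.card (MonoIdx n d) : ℝ) ≤ 2 * (2 * n) ^ d := by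
  have hn' : (1 : ℝ) ≤ n := by exact_mod_cast hn
  set r : ℝ := (2 * n : ℝ)⁻¹ with hr
  have hr0 : 0 < r := by positivity
  have hr1 : r ≤ 1 / 2 := by
    rw [hr, one_div]; gcongr; linarith
  have h1 : ∑ m : MonoIdx n d, ∏ i, r ^ (m.1 i : ℕ) ≤
      ∑ m : Fin n → Fin (d + 1), ∏ i, r ^ (m i : ℕ) := by
    rw [← Finset.sum_subtype (Finset.univ.filter fun m : Fin n → Fin (d + 1) =>
      1 ≤ ∑ i, (m i : ℕ) ∧ ∑ i, (m i : ℕ) ≤ d) (by simp) fun m => ∏ i, r ^ (m i : ℕ)]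
    exact Finset.sum_le_sum_of_subset_of_nonneg (Finset.subset_univ _)
      fun _ _ _ => by positivity
  have h2 : ∑ m : Fin n → Fin (d + 1), ∏ i, r ^ (m i : ℕ) ≤ 2 := by
    rw [← Fintype.sum_pow (fun j : Fin (d + 1) => r ^ (j : ℕ)) n,
      Fin.sum_univ_eq_sum_range (fun j => r ^ j)]
    set s := ∑ j ∈ Finset.range (d + 1), r ^ j with hs
    have hs0 : 0 ≤ s := Finset.sum_nonneg fun _ _ => by positivity
    have h3 : (1 - r) * s ≤ 1 := by
      rw [hs, mul_neg_geom_sum]; linarith [pow_pos hr0 (d + 1)]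
    have h4 : (1 / 2 : ℝ) ≤ (1 - r) ^ n := by
      have := one_add_mul_le_pow (a := -r) (by linarith) n
      have e : (n : ℝ) * r = 1 / 2 := by rw [hr]; field_simp
      rw [← sub_eq_add_neg] at this
      linarith
    have h5 : (1 - r) ^ n * s ^ n ≤ 1 := by
      rw [← mul_pow]; exact pow_le_one₀ (mul_nonneg (by linarith) hs0) h3
    have h6 := mul_le_mul_of_nonneg_right h4 (pow_nonneg hs0 n)
    linarith
  have h3 : ∑ _m : MonoIdx n d, r ^ d ≤ ∑ m : MonoIdx n d, ∏ i, r ^ (m.1 i : ℕ) := by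
    refine Finset.sum_le_sum fun m _ => ?_
    rw [Finset.prod_pow_eq_pow_sum]
    exact pow_le_pow_of_le_one hr0.le (by linarith) m.2.2
  rw [Finset.sum_const, Finset.card_univ, nsmul_eq_mul, hr, inv_pow] at h3
  have h4 := (h3.trans h1).trans h2
  rwa [← div_eq_mul_inv, div_le_iff₀ (by positivity)] at h4

/-! ### The weight under translations and dilations -/

theorem abs_prod_sub_prod_le {ι : Type*} (s : Finset ι) (a b : ι → ℝ) (l : ι → ℕ) {ρ δ : ℝ}
    (hρ : 0 ≤ ρ) (ha : ∀ i ∈ s, |a i| ≤ ρ ^ l i) (hb : ∀ i ∈ s, |b i| ≤ ρ ^ l i)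
    (hab : ∀ i ∈ s, |a i - b i| ≤ l i * δ * ρ ^ l i) :
    |∏ i ∈ s, a i - ∏ i ∈ s, b i| ≤ (∑ i ∈ s, l i : ℕ) * δ * ρ ^ (∑ i ∈ s, l i) := by
  classical
  induction s using Finset.induction_on with
  | empty => simp
  | insert i s hi ih =>
    rw [Finset.prod_insert hi, Finset.prod_insert hi, Finset.sum_insert hi]
    have h1 := ih (fun j hj => ha j (Finset.mem_insert_of_mem hj))
      (fun j hj => hb j (Finset.mem_insert_of_mem hj))
      (fun j hj => hab j (Finset.mem_insert_of_mem hj))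
    have h2 : |∏ j ∈ s, b j| ≤ ρ ^ (∑ j ∈ s, l j) := by
      rw [Finset.abs_prod, ← Finset.prod_pow_eq_pow_sum]
      exact Finset.prod_le_prod (fun _ _ => abs_nonneg _)
        fun j hj => hb j (Finset.mem_insert_of_mem hj)
    have hai := ha i (Finset.mem_insert_self i s)
    have habi := hab i (Finset.mem_insert_self i s)
    have e : a i * ∏ j ∈ s, a j - b i * ∏ j ∈ s, b j =
        a i * (∏ j ∈ s, a j - ∏ j ∈ s, b j) + (a i - b i) * ∏ j ∈ s, b j := by ring
    rw [e]
    calc _ ≤ |a i| * |∏ j ∈ s, a j - ∏ j ∈ s, b j| + |a i - b i| * |∏ j ∈ s, b j| := by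
          rw [← abs_mul, ← abs_mul]; exact abs_add_le _ _
      _ ≤ ρ ^ l i * ((∑ j ∈ s, l j : ℕ) * δ * ρ ^ (∑ j ∈ s, l j)) +
          (l i * δ * ρ ^ l i) * ρ ^ (∑ j ∈ s, l j) := by
          have := (abs_nonneg _).trans habi
          gcongr
      _ = _ := by push_cast; rw [pow_add]; ring

theorem abs_suffStat_le_pow {x : Fin n → ℝ} {ρ : ℝ} (hρ : 1 ≤ ρ) (hx : ‖x‖ ≤ ρ)
    (m : MonoIdx n d) : |suffStat d x m| ≤ ρ ^ d := by
  have e : suffStat d x m = ∏ i, x i ^ (m.1 i : ℕ) := rfl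
  rw [e, Finset.abs_prod]
  calc _ ≤ ∏ i, ρ ^ (m.1 i : ℕ) := by
        refine Finset.prod_le_prod (fun _ _ => abs_nonneg _) fun i _ => ?_
        rw [abs_pow]
        gcongr
        exact (norm_le_pi_norm x i).trans hx
    _ = ρ ^ (∑ i, (m.1 i : ℕ)) := Finset.prod_pow_eq_pow_sum _ _ _
    _ ≤ _ := pow_le_pow_right₀ hρ m.2.2

theorem abs_pow_sub_pow_le_of_le {a b ρ δ : ℝ} (hρ : 1 ≤ ρ) (ha : |a| ≤ ρ) (hb : |b| ≤ ρ)
    (hab : |a - b| ≤ δ) (k : ℕ) : |a ^ k - b ^ k| ≤ k * δ * ρ ^ k := by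
  have hδ : 0 ≤ δ := (abs_nonneg _).trans hab
  calc _ ≤ |a - b| * k * max |a| |b| ^ (k - 1) := abs_pow_sub_pow_le a b k
    _ ≤ δ * k * ρ ^ (k - 1) := by gcongr; exact max_le ha hb
    _ ≤ δ * k * ρ ^ k := by gcongr; exact Nat.sub_le k 1
    _ = _ := by ring

theorem abs_suffStat_sub_le {x y : Fin n → ℝ} {ρ δ : ℝ} (hρ : 1 ≤ ρ) (hx : ‖x‖ ≤ ρ)
    (hy : ‖y‖ ≤ ρ) (hxy : ‖x - y‖ ≤ δ) (m : MonoIdx n d) :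
    |suffStat d x m - suffStat d y m| ≤ d * δ * ρ ^ d := by
  have hδ : 0 ≤ δ := (norm_nonneg _).trans hxy
  have h := abs_prod_sub_prod_le (δ := δ) Finset.univ (fun i => x i ^ (m.1 i : ℕ))
    (fun i => y i ^ (m.1 i : ℕ)) (fun i => (m.1 i : ℕ)) (zero_le_one.trans hρ)
    (fun i _ => by
      rw [abs_pow]; gcongr; exact (norm_le_pi_norm x i).trans hx)
    (fun i _ => by
      rw [abs_pow]; gcongr; exact (norm_le_pi_norm y i).trans hy)
    (fun i _ => abs_pow_sub_pow_le_of_le hρ ((norm_le_pi_norm x i).trans hx)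
      ((norm_le_pi_norm y i).trans hy) ((norm_le_pi_norm (x - y) i).trans hxy) _)
  refine h.trans ?_
  have : ((∑ i, (m.1 i : ℕ) : ℕ) : ℝ) ≤ d := by exact_mod_cast m.2.2
  gcongr
  exact m.2.2

theorem abs_inner_le_of_forall_abs_le {B t : ℝ} {θ : Param n d} (hθ : θ ∈ paramBall n d B)
    {v : Param n d} (hv : ∀ m, |v m| ≤ t) :
    |inner ℝ θ v| ≤ Fintype.card (MonoIdx n d) * (B * t) := by
  rw [PiLp.inner_apply]
  refine (Finset.abs_sum_le_sum_abs _ _).trans ?_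
  rw [← nsmul_eq_mul, ← Finset.card_univ]
  refine Finset.sum_le_card_nsmul _ _ _ fun m _ => ?_
  have h1 := hθ m
  have hB := (abs_nonneg _).trans h1
  rw [RCLike.inner_apply, abs_mul, mul_comm]
  simp only [conj_trivial]
  gcongr
  exact hv m

/-- The weight changes at most by a constant factor under small translations. -/
theorem weight_le_four_mul {B ρ δ : ℝ} {θ : Param n d} (hθ : θ ∈ paramBall n d B) (hρ : 1 ≤ ρ)
    (hδ : (n * (d + 1) * ρ + Fintype.card (MonoIdx n d) * (B * d)) * δ * ρ ^ d ≤ 1)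
    {x s : Fin n → ℝ} (hx : ‖x‖ + δ ≤ ρ) (hs : ‖s‖ ≤ δ) :
    weight θ x ≤ 4 * weight θ (x + s) := by
  have hδ0 : 0 ≤ δ := (norm_nonneg _).trans hs
  have hx' : ‖x‖ ≤ ρ := by linarith
  have hxs : ‖x + s‖ ≤ ρ := (norm_add_le _ _).trans (by linarith)
  have hd : ‖x + s - x‖ ≤ δ := by simpa using hs
  rw [weight_eq_exp, weight_eq_exp]
  have h1 : |∑ i, (x + s) i ^ (d + 1) - ∑ i, x i ^ (d + 1)| ≤
      n * ((d + 1 : ℕ) * δ * ρ ^ (d + 1)) := by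
    rw [← Finset.sum_sub_distrib]
    refine (Finset.abs_sum_le_sum_abs _ _).trans ?_
    have h := Finset.sum_le_card_nsmul (Finset.univ : Finset (Fin n))
      (fun i => |(x + s) i ^ (d + 1) - x i ^ (d + 1)|) ((d + 1 : ℕ) * δ * ρ ^ (d + 1))
      fun i _ => abs_pow_sub_pow_le_of_le hρ ((norm_le_pi_norm _ i).trans hxs)
        ((norm_le_pi_norm x i).trans hx') ((norm_le_pi_norm (x + s - x) i).trans hd) _
    simpa using h
  have h2 : |inner ℝ θ (suffStat d (x + s) - suffStat d x)| ≤
      Fintype.card (MonoIdx n d) * (B * (d * δ * ρ ^ d)) :=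
    abs_inner_le_of_forall_abs_le hθ fun m => abs_suffStat_sub_le hρ hxs hx' hd m
  rw [inner_sub_right] at h2
  have h3 : n * ((d + 1 : ℕ) * δ * ρ ^ (d + 1)) +
      Fintype.card (MonoIdx n d) * (B * (d * δ * ρ ^ d)) ≤ 1 := by
    refine le_trans (le_of_eq ?_) hδ
    push_cast
    ring
  have h4 : Real.exp 1 ≤ 4 := by linarith [Real.exp_one_lt_three]
  calc _ ≤ Real.exp (1 + (-∑ i, (x + s) i ^ (d + 1) + inner ℝ θ (suffStat d (x + s)))) := by
        rw [Real.exp_le_exp]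
        have := abs_le.1 h1
        have := abs_le.1 h2
        linarith
    _ = Real.exp 1 * Real.exp _ := Real.exp_add _ _
    _ ≤ _ := by gcongr

/-- Outside of a large cube, halving the argument multiplies the weight by at least `2ⁿ⁺¹`. -/
theorem two_pow_mul_weight_le [hd : Fact (Odd d)] {B R : ℝ} {θ : Param n d}
    (hθ : θ ∈ paramBall n d B) (hB : 0 ≤ B)
    (hR : 2 * (Fintype.card (MonoIdx n d) * B + n + 1) ≤ R) {x : Fin n → ℝ} (hx : R < ‖x‖) :
    2 ^ (n + 1) * weight θ x ≤ weight θ ((1 / 2 : ℝ) • x) := by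
  have hMB : 0 ≤ Fintype.card (MonoIdx n d) * B := by positivity
  have hx1 : 1 ≤ ‖x‖ := by
    have : (0 : ℝ) ≤ n := by positivity
    linarith
  have hne : Nonempty (Fin n) := by
    by_contra h
    rw [not_nonempty_iff] at h
    have : x = 0 := Subsingleton.elim _ _
    simp [this] at hx1
    linarith
  have heven : Even (d + 1) := hd.out.add_one
  have h1 : 1 / 2 * ‖x‖ ^ (d + 1) ≤ ∑ i, x i ^ (d + 1) - ∑ i, ((1 / 2 : ℝ) • x) i ^ (d + 1) := by
    obtain ⟨i, hi⟩ := Finite.exists_max fun i => ‖x i‖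
    have hnx : ‖x‖ = |x i| := le_antisymm
      ((pi_norm_le_iff_of_nonneg (norm_nonneg _)).2 hi) (norm_le_pi_norm x i)
    rw [← Finset.sum_sub_distrib, hnx, heven.pow_abs]
    have hterm : ∀ j, 1 / 2 * x j ^ (d + 1) ≤ x j ^ (d + 1) - ((1 / 2 : ℝ) • x) j ^ (d + 1) := by
      intro j
      simp only [Pi.smul_apply, smul_eq_mul, mul_pow]
      have hp : 0 ≤ x j ^ (d + 1) := heven.pow_nonneg _
      have : (1 / 2 : ℝ) ^ (d + 1) ≤ 1 / 2 :=
        pow_le_of_le_one (by norm_num) (by norm_num) (by omega)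
      nlinarith
    refine (hterm i).trans ?_
    exact Finset.single_le_sum
      (f := fun j => x j ^ (d + 1) - ((1 / 2 : ℝ) • x) j ^ (d + 1))
      (fun j _ => le_trans (mul_nonneg (by norm_num) (heven.pow_nonneg _)) (hterm j))
      (Finset.mem_univ i)
  have h2 : |inner ℝ θ (suffStat d x - suffStat d ((1 / 2 : ℝ) • x))| ≤
      Fintype.card (MonoIdx n d) * (B * ‖x‖ ^ d) := by
    refine abs_inner_le_of_forall_abs_le hθ fun m => ?_
    have e : suffStat d ((1 / 2 : ℝ) • x) m =
        (1 / 2) ^ (∑ i, (m.1 i : ℕ)) * suffStat d x m := by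
      change ∏ i, ((1 / 2 : ℝ) * x i) ^ (m.1 i : ℕ) = _ * ∏ i, x i ^ (m.1 i : ℕ)
      simp only [mul_pow, Finset.prod_mul_distrib, Finset.prod_pow_eq_pow_sum]
    rw [PiLp.sub_apply, e, ← one_sub_mul, abs_mul]
    have h01 : (1 / 2 : ℝ) ^ (∑ i, (m.1 i : ℕ)) ≤ 1 :=
      pow_le_one₀ (by norm_num) (by norm_num)
    have h00 : (0 : ℝ) ≤ (1 / 2 : ℝ) ^ (∑ i, (m.1 i : ℕ)) := by positivity
    rw [abs_of_nonneg (by linarith)]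
    refine le_trans (mul_le_of_le_one_left (abs_nonneg _) (by linarith)) ?_
    exact abs_suffStat_le_pow hx1 le_rfl m
  rw [inner_sub_right] at h2
  have h3 := (abs_le.1 h2).2
  have h4 : (n + 1 : ℝ) ≤ 1 / 2 * ‖x‖ ^ (d + 1) - Fintype.card (MonoIdx n d) * (B * ‖x‖ ^ d) := by
    have hp : 1 ≤ ‖x‖ ^ d := one_le_pow₀ hx1
    have : 1 / 2 * ‖x‖ ^ (d + 1) - Fintype.card (MonoIdx n d) * (B * ‖x‖ ^ d) =
        (‖x‖ / 2 - Fintype.card (MonoIdx n d) * B) * ‖x‖ ^ d := by ring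
    rw [this]
    have hn : (n + 1 : ℝ) ≤ ‖x‖ / 2 - Fintype.card (MonoIdx n d) * B := by linarith
    exact le_trans hn (le_mul_of_one_le_right (le_trans (by positivity) hn) hp)
  have h5 : (2 : ℝ) ^ (n + 1) ≤ Real.exp (n + 1) := by
    have : (2 : ℝ) ≤ Real.exp 1 := by linarith [Real.add_one_le_exp (1 : ℝ)]
    calc (2 : ℝ) ^ (n + 1) ≤ Real.exp 1 ^ (n + 1) := by gcongr
      _ = _ := by rw [← Real.exp_nat_mul]; push_cast; ring_nf
  rw [weight_eq_exp, weight_eq_exp]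
  calc _ ≤ Real.exp (n + 1) * Real.exp (-∑ i, x i ^ (d + 1) + inner ℝ θ (suffStat d x)) := by
        gcongr
    _ ≤ _ := by
        rw [← Real.exp_add, Real.exp_le_exp]
        linarith

/-- At least half of the mass lies in a cube of polynomial size. -/
theorem half_partitionFn_le [Fact (Odd d)] {B R : ℝ} {θ : Param n d}
    (hθ : θ ∈ paramBall n d B) (hB : 0 ≤ B)
    (hR : 2 * (Fintype.card (MonoIdx n d) * B + n + 1) ≤ R) :
    partitionFn θ ≤ 2 * ∫ x in Metric.closedBall 0 R, weight θ x := by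
  have hint := integrable_weight θ
  have hint2 : Integrable fun x : Fin n → ℝ => weight θ ((1 / 2 : ℝ) • x) :=
    hint.comp_smul (by norm_num)
  have h1 : 2 ^ (n + 1) * ∫ x in (Metric.closedBall 0 R)ᶜ, weight θ x ≤ 2 ^ n * partitionFn θ := by
    rw [← integral_const_mul]
    calc _ ≤ ∫ x in (Metric.closedBall 0 R)ᶜ, weight θ ((1 / 2 : ℝ) • x) := by
          refine setIntegral_mono_on (hint.const_mul _).integrableOn hint2.integrableOn
            Metric.isClosed_closedBall.measurableSet.compl fun x hx => ?_
          exact two_pow_mul_weight_le hθ hB hR (by simpa using hx)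
      _ ≤ ∫ x, weight θ ((1 / 2 : ℝ) • x) :=
          setIntegral_le_integral hint2 (ae_of_all _ fun x => (weight_pos _ _).le)
      _ = _ := by
          rw [Measure.integral_comp_smul, Module.finrank_fin_fun]
          simp [partitionFn]
  have h2 := integral_add_compl
    (Metric.isClosed_closedBall (x := (0 : Fin n → ℝ)) (ε := R)).measurableSet hint
  change _ = partitionFn θ at h2
  have h3 : 2 * ∫ x in (Metric.closedBall 0 R)ᶜ, weight θ x ≤ partitionFn θ := by
    rw [pow_succ, mul_assoc] at h1
    exact le_of_mul_le_mul_left h1 (by positivity)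
  linarith

/-! ### Anti-concentration of polynomials -/

/-- If a translation by `s` is controlled by the weight on a cube, translated functions are
controlled there by the integral of the original function. -/
theorem setIntegral_shift_le [Fact (Odd d)] (θ : Param n d) {R : ℝ} {f : (Fin n → ℝ) → ℝ}
    (hf : Continuous f) (hf0 : ∀ x, 0 ≤ f x) (hfi : Integrable f (law θ)) (s : Fin n → ℝ)
    (hs : ∀ x ∈ Metric.closedBall 0 R, weight θ x ≤ 4 * weight θ (x + s)) :
    ∫ x in Metric.closedBall 0 R, f (x + s) * weight θ x ≤ 4 * ∫ x, f x * weight θ x := by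
  have hw := continuous_weight θ
  rw [integrable_law_iff] at hfi
  have hsh := hfi.comp_add_right s
  rw [← integral_add_right_eq_self (fun x => f x * weight θ x) s, ← integral_const_mul]
  calc _ ≤ ∫ x in Metric.closedBall 0 R, 4 * (f (x + s) * weight θ (x + s)) := by
        refine setIntegral_mono_on ?_ (hsh.const_mul 4).integrableOn
          Metric.isClosed_closedBall.measurableSet fun x hx => ?_
        · exact Continuous.continuousOn (by fun_prop) |>.integrableOn_compact
            (isCompact_closedBall _ _)
        · have := mul_le_mul_of_nonneg_left (hs x hx) (hf0 (x + s))
          linarith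
    _ ≤ _ := setIntegral_le_integral (hsh.const_mul 4) (ae_of_all _ fun x =>
        mul_nonneg (by norm_num) (mul_nonneg (hf0 _) (weight_pos _ _).le))

theorem sq_le_two_mul_exp {t : ℝ} (ht : 0 ≤ t) : t ^ 2 ≤ 2 * Real.exp t := by
  have := Real.quadratic_le_exp_of_nonneg ht
  nlinarith

theorem memLp_two_of_integrable_exp {Ω E : Type*} [MeasurableSpace Ω] {P : Measure Ω}
    [NormedAddCommGroup E] {Y : Ω → E} (hYm : AEStronglyMeasurable Y P)
    (hY : ∀ c : ℝ, Integrable (fun ω => Real.exp (c * ‖Y ω‖)) P) : MemLp Y 2 P := by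
  rw [memLp_two_iff_integrable_sq_norm hYm]
  refine ((hY 1).const_mul 2).mono' (hYm.norm.pow 2) (ae_of_all _ fun x => ?_)
  rw [Real.norm_eq_abs, abs_of_nonneg (sq_nonneg _), one_mul]
  exact sq_le_two_mul_exp (norm_nonneg _)

theorem integrable_sq_inner_sub [Fact (Odd d)] (θ v : Param n d) (c : ℝ) :
    Integrable (fun x => (inner ℝ v (suffStat d x) - c) ^ 2) (law θ) := by
  have hcont := continuous_suffStat (n := n) (d := d)
  set a := ‖v‖ with ha
  have h1 := (integrable_exp_norm_suffStat θ (2 * a)).const_mul (2 * Real.exp (2 * |c|))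
  refine h1.mono' (Continuous.aestronglyMeasurable (by fun_prop)) (ae_of_all _ fun x => ?_)
  have h2 : |inner ℝ v (suffStat d x) - c| ≤ a * ‖suffStat d x‖ + |c| :=
    (abs_sub _ _).trans (by gcongr; exact abs_real_inner_le_norm _ _)
  set t := a * ‖suffStat d x‖ + |c| with ht
  have ht0 : 0 ≤ t := by positivity
  rw [Real.norm_eq_abs, abs_of_nonneg (sq_nonneg _)]
  calc _ = |inner ℝ v (suffStat d x) - c| ^ 2 := (sq_abs _).symm
    _ ≤ t ^ 2 := by gcongr
    _ ≤ 2 * Real.exp t := sq_le_two_mul_exp ht0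
    _ ≤ 2 * Real.exp (2 * t) := by gcongr; linarith
    _ = 2 * (Real.exp (2 * |c|) * Real.exp (2 * a * ‖suffStat d x‖)) := by
        rw [← Real.exp_add, ht]; ring_nf
    _ = _ := by ring

/-- A quantitative anti-concentration bound: the square of a non-constant polynomial of degree at
most `d` is not small on average. -/
theorem norm_sq_le_integral_sq [Fact (Odd d)] [Nonempty (MonoIdx n d)] {B R ρ ε A : ℝ}
    {θ : Param n d} (hθ : θ ∈ paramBall n d B) (hB : 0 ≤ B)
    (hR : 2 * (Fintype.card (MonoIdx n d) * B + n + 1) ≤ R) (hε : 0 ≤ ε) (hε1 : ε ≤ 1)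
    (hρ : R + d * ε ≤ ρ)
    (hδ : (n * (d + 1) * ρ + Fintype.card (MonoIdx n d) * (B * d)) * (d * ε) * ρ ^ d ≤ 1)
    (hA : 2 * Fintype.card (MonoIdx n d) * d ^ d * ρ ≤ A) (v : Param n d) (c : ℝ) :
    ε ^ (2 * d) * ‖v‖ ^ 2 ≤ 32 * 4 ^ d * Fintype.card (MonoIdx n d) * A ^ (2 * d) *
      ∫ x, (inner ℝ v (suffStat d x) - c) ^ 2 ∂law θ := by
  have hcont := continuous_suffStat (n := n) (d := d)
  have hw := continuous_weight θ
  have hMB : 0 ≤ Fintype.card (MonoIdx n d) * B := by positivity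
  have hn0 : (0 : ℝ) ≤ n := by positivity
  have hdε : 0 ≤ d * ε := by positivity
  have hρ1 : 1 ≤ ρ := by linarith
  have hA0 : 0 ≤ A := le_trans (by positivity) hA
  obtain ⟨m, hm⟩ := exists_mixedDiff_sq_ge hε hε1 hρ1 hA v
  set M : ℝ := ((Fintype.card (MonoIdx n d) : ℕ) : ℝ) with hM
  set g : (Fin n → ℝ) → ℝ := fun x => inner ℝ v (suffStat d x) - c with hg
  have hgc : Continuous g := by fun_prop
  set S : Set (Fin n → ℝ) := Metric.closedBall 0 R
  have hS : MeasurableSet S := Metric.isClosed_closedBall.measurableSet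
  have hSc : IsCompact S := isCompact_closedBall _ _
  set J : ℝ := ∫ x, g x ^ 2 * weight θ x with hJ
  have hJ0 : 0 ≤ J := integral_nonneg fun x => mul_nonneg (sq_nonneg _) (weight_pos _ _).le
  have hshift : ∀ j ∈ diffNodes m.expo,
      ∫ x in S, g (x + fun i => ε * j i) ^ 2 * weight θ x ≤ 4 * J := by
    intro j hj
    refine setIntegral_shift_le θ (f := fun x => g x ^ 2) (by fun_prop) (fun x => sq_nonneg _)
      (integrable_sq_inner_sub θ v c) _ fun x hx => ?_
    refine weight_le_four_mul hθ hρ1 hδ ?_ ?_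
    · have : ‖x‖ ≤ R := by simpa [S] using hx
      linarith
    · refine (pi_norm_le_iff_of_nonneg hdε).2 fun i => ?_
      have h1 : j i ≤ m.expo i := by
        have := Fintype.mem_piFinset.1 hj i
        simp at this
        omega
      have h2 : (j i : ℝ) ≤ d := by exact_mod_cast h1.trans (Fin.is_le (m.1 i))
      rw [Real.norm_eq_abs, abs_of_nonneg (by positivity), mul_comm]
      gcongr
  have hDi : IntegrableOn (fun x => ∑ j ∈ diffNodes m.expo,
      |diffCoeff m.expo j| * (g (x + fun i => ε * j i) ^ 2 * weight θ x)) S :=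
    Continuous.continuousOn (by fun_prop) |>.integrableOn_compact hSc
  have hD : ∫ x in S, ∑ j ∈ diffNodes m.expo,
      |diffCoeff m.expo j| * (g (x + fun i => ε * j i) ^ 2 * weight θ x) ≤ 2 ^ d * (4 * J) := by
    rw [integral_finsetSum _ fun j _ =>
      Continuous.continuousOn (by fun_prop) |>.integrableOn_compact hSc]
    simp only [integral_const_mul]
    calc _ ≤ ∑ j ∈ diffNodes m.expo, |diffCoeff m.expo j| * (4 * J) :=
          Finset.sum_le_sum fun j hj => by gcongr; exact hshift j hj
      _ = 2 ^ m.degree * (4 * J) := by rw [← Finset.sum_mul, sum_abs_diffCoeff]; rfl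
      _ ≤ _ := by gcongr; exacts [one_le_two, m.degree_le]
  have hmass := half_partitionFn_le hθ hB hR
  -- the lower bound is integrated over the cube, and the square of the difference is bounded by
  -- the squares at its nodes
  have hmain : ε ^ (2 * d) * ‖v‖ ^ 2 * ∫ x in S, weight θ x ≤
      4 * M * A ^ (2 * d) * 2 ^ d * (2 ^ d * (4 * J)) := by
    refine le_trans ?_ (mul_le_mul_of_nonneg_left hD (by positivity))
    rw [← integral_const_mul, ← integral_const_mul]
    refine setIntegral_mono_on ((integrable_weight θ).const_mul _).integrableOn
      (hDi.const_mul _) hS fun x hx => ?_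
    have hxR : ‖x‖ ≤ R := by simpa [S] using hx
    have h1 := hm c x (by linarith)
    have h2 := sq_mixedDiff_le ε m.expo g x
    have h3 : (2 : ℝ) ^ (∑ i, m.expo i) ≤ 2 ^ d := pow_le_pow_right₀ one_le_two m.degree_le
    have hwx := (weight_pos θ x).le
    have h4 : (0 : ℝ) ≤ ∑ j ∈ diffNodes m.expo,
        |diffCoeff m.expo j| * g (x + fun i => ε * j i) ^ 2 :=
      Finset.sum_nonneg fun _ _ => by positivity
    calc _ ≤ 4 * M * A ^ (2 * d) * (2 ^ d * ∑ j ∈ diffNodes m.expo,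
          |diffCoeff m.expo j| * g (x + fun i => ε * j i) ^ 2) * weight θ x := by
          refine mul_le_mul_of_nonneg_right (h1.trans ?_) hwx
          gcongr
          exact h2.trans (by gcongr)
      _ = _ := by
          simp only [← mul_assoc, ← Finset.sum_mul]
  rw [integral_law]
  have hZ := partitionFn_pos θ
  rw [mul_div_assoc', le_div_iff₀ hZ]
  have h44 : (4 : ℝ) ^ d = 2 ^ d * 2 ^ d := by rw [← mul_pow]; norm_num
  calc _ ≤ ε ^ (2 * d) * ‖v‖ ^ 2 * (2 * ∫ x in S, weight θ x) := by gcongr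
    _ = 2 * (ε ^ (2 * d) * ‖v‖ ^ 2 * ∫ x in S, weight θ x) := by ring
    _ ≤ 2 * (4 * M * A ^ (2 * d) * 2 ^ d * (2 ^ d * (4 * J))) := by gcongr
    _ = _ := by rw [h44]; ring

/-! ### Explicit constants -/

/-- The quantity `max 2 (n * B)` whose powers bound the condition number of the problem. -/
def scaleParam (n : ℕ) (B : ℝ) : ℝ := max 2 (n * B)

theorem two_le_scaleParam (n : ℕ) (B : ℝ) : 2 ≤ scaleParam n B := le_max_left _ _

theorem card_monoIdx_le_pow {B : ℝ} (hn : 1 ≤ n) (hB : 1 ≤ B) (hd : 1 ≤ d) :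
    (Fintype.card (MonoIdx n d) : ℝ) ≤ scaleParam n B ^ (3 * d) := by
  have hb := two_le_scaleParam n B
  have hnb : (n : ℝ) ≤ scaleParam n B :=
    (le_mul_of_one_le_right (by positivity) hB).trans (le_max_right _ _)
  set b := scaleParam n B
  calc _ ≤ 2 * (2 * n : ℝ) ^ d := card_monoIdx_le hn
    _ ≤ b * (b * b) ^ d := by gcongr
    _ = b ^ (1 + 2 * d) := by rw [← pow_two, ← pow_mul, pow_add, pow_one]
    _ ≤ _ := pow_le_pow_right₀ (by linarith) (by omega)

theorem nonempty_monoIdx (hn : 1 ≤ n) (hd : 1 ≤ d) : Nonempty (MonoIdx n d) := by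
  refine ⟨⟨fun i => if i = ⟨0, hn⟩ then ⟨1, by omega⟩ else 0, ?_⟩⟩
  have : ∑ i : Fin n, (((if i = ⟨0, hn⟩ then ⟨1, by omega⟩ else 0 : Fin (d + 1))) : ℕ) = 1 := by
    rw [Finset.sum_eq_single ⟨0, hn⟩] <;> simp +contextual
  rw [this]
  exact ⟨le_rfl, hd⟩

/-- The variance of a linear form in the sufficient statistics is bounded below, with polynomial
dependence on `n` and `B`. -/
theorem norm_sq_le_scaleParam_pow_mul_integral_sq [hd : Fact (Odd d)] {B : ℝ} {θ : Param n d}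
    (hn : 1 ≤ n) (hB : 1 ≤ B) (hθ : θ ∈ paramBall n d B) (v : Param n d) (c : ℝ) :
    ‖v‖ ^ 2 ≤ scaleParam n B ^ (70 * d ^ 3) *
      ∫ x, (inner ℝ v (suffStat d x) - c) ^ 2 ∂law θ := by
  have hd1 : 1 ≤ d := hd.out.pos
  have hne := nonempty_monoIdx hn hd1
  have hMb := card_monoIdx_le_pow (n := n) hn hB hd1
  have hb := two_le_scaleParam n B
  have hn' : (1 : ℝ) ≤ n := by exact_mod_cast hn
  have hnb : (n : ℝ) ≤ scaleParam n B :=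
    (le_mul_of_one_le_right (by positivity) hB).trans (le_max_right _ _)
  have hBb : B ≤ scaleParam n B :=
    (le_mul_of_one_le_left (by positivity) hn').trans (le_max_right _ _)
  set b := scaleParam n B
  have hb1 : 1 ≤ b := by linarith
  have hp {k l : ℕ} (h : k ≤ l) : b ^ k ≤ b ^ l := pow_le_pow_right₀ hb1 h
  have hdb : (d + 1 : ℝ) ≤ b ^ d := by
    have h1 : ((d + 1 : ℕ) : ℝ) ≤ ((2 ^ d : ℕ) : ℝ) := by exact_mod_cast Nat.lt_two_pow_self
    push_cast at h1
    exact h1.trans (by gcongr)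
  have hdb' : (d : ℝ) ≤ b ^ d := by linarith
  set M : ℝ := ((Fintype.card (MonoIdx n d) : ℕ) : ℝ) with hM
  have hM0 : 0 ≤ M := by positivity
  have hd2 : d ≤ d ^ 2 := Nat.le_self_pow two_ne_zero d
  have hd3 : d ≤ d ^ 3 := Nat.le_self_pow three_ne_zero d
  have hMB : M * B ≤ b ^ (4 * d) := by
    calc M * B ≤ b ^ (3 * d) * b := by gcongr
      _ = b ^ (3 * d + 1) := (pow_succ _ _).symm
      _ ≤ _ := hp (by omega)
  -- the radius of the cube
  have hR : 2 * (M * B + n + 1) ≤ b ^ (6 * d) := by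
    have h1 : (n : ℝ) + 1 ≤ b ^ (4 * d) := by
      calc (n : ℝ) + 1 ≤ b * b := by nlinarith
        _ = b ^ 2 := (pow_two b).symm
        _ ≤ _ := hp (by omega)
    have h0 : 0 ≤ b ^ (4 * d) := by positivity
    calc _ ≤ b ^ (4 * d) * (2 * 2) := by linarith
      _ ≤ b ^ (4 * d) * (b * b) := by gcongr
      _ = b ^ (4 * d + 2) := by rw [pow_add, pow_two]
      _ ≤ _ := hp (by omega)
  -- the step: the log-weight has Lipschitz constant at most `b ^ (17 * d ^ 2)` on the cube, and
  -- the nodes are at distance at most `d * ε`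
  set ε : ℝ := (b ^ (18 * d ^ 2))⁻¹ with hε
  have hε0 : 0 < ε := by positivity
  have hε1 : ε ≤ 1 := inv_le_one_of_one_le₀ (one_le_pow₀ hb1)
  have hdε : d * ε ≤ 1 := by
    rw [hε, ← div_eq_mul_inv, div_le_one (by positivity)]
    exact hdb'.trans (hp (by omega))
  have hρ : b ^ (6 * d) + d * ε ≤ b ^ (7 * d) := by
    have h1 : 1 ≤ b ^ (6 * d) := one_le_pow₀ hb1
    calc _ ≤ b ^ (6 * d) * 2 := by linarith
      _ ≤ b ^ (6 * d) * b := by gcongr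
      _ = b ^ (6 * d + 1) := (pow_succ _ _).symm
      _ ≤ _ := hp (by omega)
  have hδ : (n * (d + 1) * b ^ (7 * d) + M * (B * d)) * (d * ε) * (b ^ (7 * d)) ^ d ≤ 1 := by
    have h1 : n * (d + 1) * b ^ (7 * d) ≤ b ^ (9 * d) := by
      calc _ ≤ b * b ^ d * b ^ (7 * d) := by gcongr
        _ = b ^ (1 + d + 7 * d) := by rw [pow_add, pow_add, pow_one]
        _ ≤ _ := hp (by omega)
    have h2 : M * (B * d) ≤ b ^ (9 * d) := by
      calc _ = M * B * d := by ring
        _ ≤ b ^ (4 * d) * b ^ d := by gcongr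
        _ = b ^ (4 * d + d) := (pow_add _ _ _).symm
        _ ≤ _ := hp (by omega)
    have h3 : n * (d + 1) * b ^ (7 * d) + M * (B * d) ≤ b ^ (10 * d) := by
      calc _ ≤ b ^ (9 * d) * 2 := by linarith
        _ ≤ b ^ (9 * d) * b := by gcongr
        _ = b ^ (9 * d + 1) := (pow_succ _ _).symm
        _ ≤ _ := hp (by omega)
    calc _ ≤ b ^ (10 * d) * (b ^ d * ε) * (b ^ (7 * d)) ^ d := by gcongr
      _ = b ^ (10 * d + d + 7 * d * d) / b ^ (18 * d ^ 2) := by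
          rw [hε, ← pow_mul, pow_add, pow_add]; ring
      _ ≤ 1 := by
          rw [div_le_one (by positivity)]
          exact hp (by nlinarith)
  have hA : 2 * M * d ^ d * b ^ (7 * d) ≤ b ^ (12 * d ^ 2) := by
    calc _ ≤ b * b ^ (3 * d) * (b ^ d) ^ d * b ^ (7 * d) := by gcongr
      _ = b ^ (1 + 3 * d + d * d + 7 * d) := by
          rw [← pow_mul, pow_add, pow_add, pow_add, pow_one]
      _ ≤ _ := hp (by nlinarith)
  have key := norm_sq_le_integral_sq hθ (by linarith) hR hε0.le hε1 hρ hδ hA v c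
  set I := ∫ x, (inner ℝ v (suffStat d x) - c) ^ 2 ∂law θ
  have hI : 0 ≤ I := integral_nonneg fun x => sq_nonneg _
  rw [hε, inv_pow, inv_mul_le_iff₀ (by positivity)] at key
  refine key.trans ?_
  have h32 : (32 : ℝ) ≤ b ^ 5 := by
    calc (32 : ℝ) = 2 ^ 5 := by norm_num
      _ ≤ _ := by gcongr
  have h4 : (4 : ℝ) ^ d ≤ (b ^ 2) ^ d := by
    gcongr; nlinarith
  calc _ ≤ (b ^ (18 * d ^ 2)) ^ (2 * d) *
        (b ^ 5 * (b ^ 2) ^ d * b ^ (3 * d) * (b ^ (12 * d ^ 2)) ^ (2 * d) * I) := by gcongr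
    _ = b ^ (18 * d ^ 2 * (2 * d) + 5 + 2 * d + 3 * d + 12 * d ^ 2 * (2 * d)) * I := by
        simp only [← pow_mul, pow_add]; ring
    _ ≤ _ := by
        gcongr
        have : d ^ 2 * d = d ^ 3 := by ring
        nlinarith

theorem memLp_suffStat [Fact (Odd d)] (θ : Param n d) : MemLp (suffStat d) 2 (law θ) :=
  memLp_two_of_integrable_exp continuous_suffStat.aestronglyMeasurable
    (integrable_exp_norm_suffStat θ)

theorem memLp_suffStat_apply [Fact (Odd d)] (θ : Param n d) (m : MonoIdx n d) :
    MemLp (fun x => suffStat d x m) 2 (law θ) :=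
  (memLp_suffStat θ).continuousLinearMap_comp (EuclideanSpace.proj m : Param n d →L[ℝ] ℝ)

/-! ### The Fisher information -/

/-- The covariance operator of the sufficient statistics. -/
def fisherOp (θ : Param n d) : Param n d →L[ℝ] Param n d :=
  Matrix.toEuclideanCLM (𝕜 := ℝ) (fisherInfo θ)

/-- The inverse of the Fisher information, as an operator. -/
def fisherOpInv (θ : Param n d) : Param n d →L[ℝ] Param n d :=
  Matrix.toEuclideanCLM (𝕜 := ℝ) (fisherInfo θ)⁻¹

/-- The mean of the sufficient statistics. -/
def meanStat (θ : Param n d) : Param n d := ∫ x, suffStat d x ∂law θ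

theorem inner_meanStat [Fact (Odd d)] (θ v : Param n d) :
    inner ℝ v (meanStat θ) = ∫ x, inner ℝ v (suffStat d x) ∂law θ :=
  (integral_inner ((memLp_suffStat θ).integrable one_le_two) v).symm

theorem inner_fisherOp [Fact (Odd d)] (θ v : Param n d) :
    inner ℝ v (fisherOp θ v) = Var[fun x => inner ℝ v (suffStat d x); law θ] := by
  have hT := memLp_suffStat_apply θ
  rw [variance_eq_sub ((memLp_suffStat θ).const_inner v), fisherOp, Matrix.inner_toEuclideanCLM]
  have h1 : ∀ x : Fin n → ℝ, inner ℝ v (suffStat d x) = ∑ m, v m * suffStat d x m := fun x => by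
    simp [PiLp.inner_apply, mul_comm]
  have h2 : ∫ x, inner ℝ v (suffStat d x) ∂law θ = ∑ m, v m * ∫ x, suffStat d x m ∂law θ := by
    simp only [h1]
    rw [integral_finsetSum _ fun m _ => ((hT m).integrable one_le_two).const_mul _]
    simp only [integral_const_mul]
  have h3 : (law θ)[(fun x => inner ℝ v (suffStat d x)) ^ 2] =
      ∑ a, ∑ b, v a * v b * ∫ x, suffStat d x a * suffStat d x b ∂law θ := by
    have hi (a b) : Integrable (fun x => v a * v b * (suffStat d x a * suffStat d x b)) (law θ) :=
      ((hT a).integrable_mul (hT b)).const_mul _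
    have e (x : Fin n → ℝ) : inner ℝ v (suffStat d x) ^ 2 =
        ∑ a, ∑ b, v a * v b * (suffStat d x a * suffStat d x b) := by
      rw [h1, sq, Finset.sum_mul_sum]
      exact Finset.sum_congr rfl fun a _ => Finset.sum_congr rfl fun b _ => by ring
    simp only [Pi.pow_apply, e]
    rw [integral_finsetSum _ fun a _ => integrable_finsetSum _ fun b _ => hi a b]
    refine Finset.sum_congr rfl fun a _ => ?_
    rw [integral_finsetSum _ fun b _ => hi a b]
    simp only [integral_const_mul]
  rw [h2, h3, sq, Finset.sum_mul_sum, ← Finset.sum_sub_distrib]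
  refine Finset.sum_congr rfl fun a _ => ?_
  rw [← Finset.sum_sub_distrib, Matrix.mulVec, dotProduct, Finset.mul_sum]
  refine Finset.sum_congr rfl fun b _ => ?_
  rw [fisherInfo, Matrix.of_apply]
  ring

theorem inner_fisherOp_eq_integral [Fact (Odd d)] (θ v : Param n d) :
    inner ℝ v (fisherOp θ v) = ∫ x, inner ℝ v (suffStat d x - meanStat θ) ^ 2 ∂law θ := by
  rw [inner_fisherOp, variance_eq_integral
    (continuous_const.inner continuous_suffStat).aemeasurable, ← inner_meanStat]
  simp only [inner_sub_right]

theorem norm_sq_le_inner_fisherOp [hd : Fact (Odd d)] {B : ℝ} {θ : Param n d}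
    (hn : 1 ≤ n) (hB : 1 ≤ B) (hθ : θ ∈ paramBall n d B) (v : Param n d) :
    ‖v‖ ^ 2 ≤ scaleParam n B ^ (70 * d ^ 3) * inner ℝ v (fisherOp θ v) := by
  rw [inner_fisherOp_eq_integral]
  simpa only [inner_sub_right] using
    norm_sq_le_scaleParam_pow_mul_integral_sq hn hB hθ v (inner ℝ v (meanStat θ))

theorem fisherInfo_posDef [hd : Fact (Odd d)] {B : ℝ} {θ : Param n d}
    (hn : 1 ≤ n) (hB : 1 ≤ B) (hθ : θ ∈ paramBall n d B) : (fisherInfo θ).PosDef := by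
  refine Matrix.PosDef.of_dotProduct_mulVec_pos (fisherInfo_isHermitian θ) fun x hx => ?_
  have h := norm_sq_le_inner_fisherOp hn hB hθ (WithLp.toLp 2 x)
  rw [fisherOp, Matrix.inner_toEuclideanCLM] at h
  have hb := two_le_scaleParam n B
  have hx' : 0 < ‖WithLp.toLp 2 x‖ ^ 2 := by
    have : WithLp.toLp 2 x ≠ 0 := by simpa using hx
    positivity
  have h2 := hx'.trans_le h
  simpa using pos_of_mul_pos_right h2 (by positivity)

theorem le_fisherLambdaMin [hd : Fact (Odd d)] {B : ℝ} {θ : Param n d}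
    (hn : 1 ≤ n) (hB : 1 ≤ B) (hθ : θ ∈ paramBall n d B) :
    (scaleParam n B ^ (70 * d ^ 3))⁻¹ ≤ fisherLambdaMin θ := by
  have hne := nonempty_monoIdx hn hd.out.pos
  have hb := two_le_scaleParam n B
  refine le_ciInf fun i => ?_
  have h := norm_sq_le_inner_fisherOp hn hB hθ ((fisherInfo_isHermitian θ).eigenvectorBasis i)
  rw [fisherOp, Matrix.inner_toEuclideanCLM, (OrthonormalBasis.orthonormal _).1 i] at h
  rw [(fisherInfo_isHermitian θ).eigenvalues_eq i, inv_le_iff_one_le_mul₀' (by positivity)]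
  simpa using h

theorem fisherOp_fisherOpInv {θ : Param n d} (h : (fisherInfo θ).PosDef) (u : Param n d) :
    fisherOp θ (fisherOpInv θ u) = u := by
  rw [fisherOp, fisherOpInv, ← mul_apply_eq_comp, ← map_mul,
    Matrix.mul_nonsing_inv _ ((Matrix.isUnit_iff_isUnit_det _).1 h.isUnit), map_one]
  rfl

theorem opNorm_inv_le [hd : Fact (Odd d)] {B : ℝ} {θ : Param n d}
    (hn : 1 ≤ n) (hB : 1 ≤ B) (hθ : θ ∈ paramBall n d B) :
    opNorm (fisherInfo θ)⁻¹ ≤ scaleParam n B ^ (70 * d ^ 3) := by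
  have hb := two_le_scaleParam n B
  refine ContinuousLinearMap.opNorm_le_bound _ (by positivity) fun u => ?_
  change ‖fisherOpInv θ u‖ ≤ _
  have h := norm_sq_le_inner_fisherOp hn hB hθ (fisherOpInv θ u)
  rw [fisherOp_fisherOpInv (fisherInfo_posDef hn hB hθ)] at h
  rcases (norm_nonneg (fisherOpInv θ u)).eq_or_lt with h0 | h0
  · rw [← h0]; positivity
  refine le_of_mul_le_mul_left ?_ h0
  calc _ = ‖fisherOpInv θ u‖ ^ 2 := (pow_two _).symm
    _ ≤ _ := h
    _ ≤ scaleParam n B ^ (70 * d ^ 3) * (‖fisherOpInv θ u‖ * ‖u‖) := by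
        gcongr; exact real_inner_le_norm _ _
    _ = _ := by ring

/-! ### Minimizers of convex functions -/

/-- A convex function that is larger on a sphere than at its centre attains its minimum, and all
its minimizers lie in the ball. -/
theorem exists_minimizer_and_norm_sub_le {E : Type*} [NormedAddCommGroup E] [NormedSpace ℝ E]
    [FiniteDimensional ℝ E] {G : E → ℝ} (hG : ConvexOn ℝ Set.univ G) {c : E} {r : ℝ} (hr : 0 < r)
    (h : ∀ y, ‖y - c‖ = r → G c < G y) :
    (∃ y, ∀ z, G y ≤ G z) ∧ ∀ y, (∀ z, G y ≤ G z) → ‖y - c‖ ≤ r := by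
  have hout : ∀ y, r < ‖y - c‖ → G c < G y := by
    intro y hy
    have hy0 : 0 < ‖y - c‖ := hr.trans hy
    set t := r / ‖y - c‖ with ht
    have ht0 : 0 < t := div_pos hr hy0
    have ht1 : t ≤ 1 := (div_le_one hy0).2 hy.le
    have h1 := hG.2 (Set.mem_univ c) (Set.mem_univ y) (sub_nonneg.2 ht1) ht0.le (by ring)
    have h2 : (1 - t) • c + t • y - c = t • (y - c) := by module
    have h3 := h ((1 - t) • c + t • y) (by
      rw [h2, norm_smul, Real.norm_of_nonneg ht0.le, ht, div_mul_cancel₀ _ hy0.ne'])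
    simp only [smul_eq_mul] at h1
    nlinarith
  have hcont : ContinuousOn G (Metric.closedBall c r) :=
    (hG.continuousOn isOpen_univ).mono (Set.subset_univ _)
  obtain ⟨y, hy, hmin⟩ := (isCompact_closedBall c r).exists_isMinOn
    ⟨c, Metric.mem_closedBall_self hr.le⟩ hcont
  refine ⟨⟨y, fun z => ?_⟩, fun y hy => ?_⟩
  · by_cases hz : z ∈ Metric.closedBall c r
    · exact hmin hz
    · rw [mem_closedBall_iff_norm, not_le] at hz
      exact (hmin (Metric.mem_closedBall_self hr.le)).trans (hout z hz).le
  · by_contra! hcon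
    exact absurd (hy c) (not_le.2 (hout y hcon))

section Laplace

/-! ### The cumulant generating function of a random vector -/

variable {Ω E : Type*} [MeasurableSpace Ω] {P : Measure Ω} [NormedAddCommGroup E]
  [InnerProductSpace ℝ E] {Y : Ω → E}

theorem integrable_exp_inner_sub (hYm : AEStronglyMeasurable Y P)
    (hY : ∀ c : ℝ, Integrable (fun ω => Real.exp (c * ‖Y ω‖)) P) (h w : E) :
    Integrable (fun ω => Real.exp (inner ℝ h (Y ω - w))) P := by
  refine ((hY ‖h‖).const_mul (Real.exp (‖h‖ * ‖w‖))).mono' ?_ (ae_of_all _ fun ω => ?_)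
  · exact Real.continuous_exp.comp_aestronglyMeasurable
      ((hYm.sub aestronglyMeasurable_const).const_inner)
  · rw [Real.norm_eq_abs, Real.abs_exp, ← Real.exp_add, Real.exp_le_exp]
    calc _ ≤ ‖h‖ * ‖Y ω - w‖ := real_inner_le_norm _ _
      _ ≤ ‖h‖ * (‖Y ω‖ + ‖w‖) := by gcongr; exact norm_sub_le _ _
      _ = _ := by ring

theorem integrable_exp_inner (hYm : AEStronglyMeasurable Y P)
    (hY : ∀ c : ℝ, Integrable (fun ω => Real.exp (c * ‖Y ω‖)) P) (h : E) :
    Integrable (fun ω => Real.exp (inner ℝ h (Y ω))) P := by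
  simpa using integrable_exp_inner_sub hYm hY h 0

theorem abs_exp_sub_quadratic_le (t : ℝ) :
    |Real.exp t - (1 + t + t ^ 2 / 2)| ≤ |t| ^ 3 * Real.exp |t| := by
  have h := Complex.norm_exp_sub_sum_le_norm_mul_exp (t : ℂ) 3
  have e : Complex.exp t - ∑ m ∈ Finset.range 3, (t : ℂ) ^ m / (m.factorial : ℂ) =
      ((Real.exp t - (1 + t + t ^ 2 / 2) : ℝ) : ℂ) := by
    push_cast
    simp [Finset.sum_range_succ]
  rwa [e, Complex.norm_real, Complex.norm_real, Real.norm_eq_abs, Real.norm_eq_abs] at h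

theorem abs_laplace_sub_quadratic_le [IsProbabilityMeasure P]
    (hYm : AEStronglyMeasurable Y P)
    (hY : ∀ c : ℝ, Integrable (fun ω => Real.exp (c * ‖Y ω‖)) P)
    (hmean : ∀ h, ∫ ω, inner ℝ h (Y ω) ∂P = 0) {h : E} (hh : ‖h‖ ≤ 1) :
    |∫ ω, Real.exp (inner ℝ h (Y ω)) ∂P - 1 - (∫ ω, inner ℝ h (Y ω) ^ 2 ∂P) / 2| ≤
      (6 * ∫ ω, Real.exp (2 * ‖Y ω‖) ∂P) * ‖h‖ ^ 3 := by
  have hL2 := (memLp_two_of_integrable_exp hYm hY).const_inner (𝕜 := ℝ) h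
  have hi1 : Integrable (fun ω => inner ℝ h (Y ω)) P := hL2.integrable one_le_two
  have hi2 : Integrable (fun ω => inner ℝ h (Y ω) ^ 2) P := hL2.integrable_sq
  have hi3 := integrable_exp_inner hYm hY h
  have e : ∫ ω, Real.exp (inner ℝ h (Y ω)) ∂P - 1 - (∫ ω, inner ℝ h (Y ω) ^ 2 ∂P) / 2 =
      ∫ ω, (Real.exp (inner ℝ h (Y ω)) - (1 + inner ℝ h (Y ω) + inner ℝ h (Y ω) ^ 2 / 2)) ∂P := by
    have hi4 : Integrable (fun ω => 1 + inner ℝ h (Y ω)) P := (integrable_const _).add hi1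
    have hi5 : Integrable (fun ω => 1 + inner ℝ h (Y ω) + inner ℝ h (Y ω) ^ 2 / 2) P :=
      hi4.add (hi2.div_const 2)
    rw [integral_sub hi3 hi5, integral_add hi4 (hi2.div_const 2),
      integral_add (integrable_const _) hi1, hmean, integral_div]
    simp
    ring
  rw [e, ← Real.norm_eq_abs, ← integral_const_mul, ← integral_mul_const]
  refine norm_integral_le_of_norm_le (((hY 2).const_mul 6).mul_const _) (ae_of_all _ fun ω => ?_)
  have h1 : |inner ℝ h (Y ω)| ≤ ‖h‖ * ‖Y ω‖ := abs_real_inner_le_norm _ _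
  have h2 : |inner ℝ h (Y ω)| ≤ ‖Y ω‖ :=
    h1.trans (mul_le_of_le_one_left (norm_nonneg _) hh)
  have h3 : ‖Y ω‖ ^ 3 ≤ 6 * Real.exp ‖Y ω‖ := by
    have := Real.pow_div_factorial_le_exp ‖Y ω‖ (norm_nonneg _) 3
    simp only [Nat.factorial] at this
    norm_num at this
    linarith
  calc _ ≤ |inner ℝ h (Y ω)| ^ 3 * Real.exp |inner ℝ h (Y ω)| := abs_exp_sub_quadratic_le _
    _ ≤ (‖h‖ * ‖Y ω‖) ^ 3 * Real.exp ‖Y ω‖ := by gcongr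
    _ = ‖Y ω‖ ^ 3 * (‖h‖ ^ 3 * Real.exp ‖Y ω‖) := by ring
    _ ≤ (6 * Real.exp ‖Y ω‖) * (‖h‖ ^ 3 * Real.exp ‖Y ω‖) := by gcongr
    _ = 6 * (Real.exp ‖Y ω‖ * Real.exp ‖Y ω‖) * ‖h‖ ^ 3 := by ring
    _ = _ := by rw [← Real.exp_add, two_mul]

/-- Second-order expansion of the cumulant generating function of a centred random vector. -/
theorem log_laplace_sub_quadratic_isLittleO [IsProbabilityMeasure P]
    (hYm : AEStronglyMeasurable Y P)
    (hY : ∀ c : ℝ, Integrable (fun ω => Real.exp (c * ‖Y ω‖)) P)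
    (hmean : ∀ h, ∫ ω, inner ℝ h (Y ω) ∂P = 0) :
    (fun h : E => Real.log (∫ ω, Real.exp (inner ℝ h (Y ω)) ∂P) -
      (∫ ω, inner ℝ h (Y ω) ^ 2 ∂P) / 2) =o[𝓝 0] fun h => ‖h‖ ^ 2 := by
  set Φ : E → ℝ := fun h => ∫ ω, Real.exp (inner ℝ h (Y ω)) ∂P with hΦ
  set q : E → ℝ := fun h => (∫ ω, inner ℝ h (Y ω) ^ 2 ∂P) / 2 with hq
  have hL2 := memLp_two_of_integrable_exp hYm hY
  have hn0 : Tendsto (fun h : E => ‖h‖) (𝓝 0) (𝓝 0) := by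
    simpa using (continuous_norm (E := E)).tendsto 0
  have h1 : (fun h => Φ h - 1 - q h) =o[𝓝 0] fun h => ‖h‖ ^ 2 := by
    have hO : (fun h => Φ h - 1 - q h) =O[𝓝 0] fun h => ‖h‖ ^ 3 := by
      refine Asymptotics.IsBigO.of_bound (6 * ∫ ω, Real.exp (2 * ‖Y ω‖) ∂P) ?_
      filter_upwards [Metric.closedBall_mem_nhds (0 : E) one_pos] with h hh
      rw [Real.norm_eq_abs, Real.norm_eq_abs, abs_of_nonneg (pow_nonneg (norm_nonneg h) 3)]
      exact abs_laplace_sub_quadratic_le hYm hY hmean (by simpa using hh)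
    refine hO.trans_isLittleO ?_
    exact (Asymptotics.isLittleO_pow_pow (m := 2) (n := 3) (by norm_num)).comp_tendsto hn0
  have h2 : q =O[𝓝 0] fun h => ‖h‖ ^ 2 := by
    refine Asymptotics.IsBigO.of_bound (∫ ω, ‖Y ω‖ ^ 2 ∂P) (Eventually.of_forall fun h => ?_)
    have hle : ∫ ω, inner ℝ h (Y ω) ^ 2 ∂P ≤ ∫ ω, ‖h‖ ^ 2 * ‖Y ω‖ ^ 2 ∂P := by
      refine integral_mono (hL2.const_inner h).integrable_sq
        (((memLp_two_iff_integrable_sq_norm hYm).1 hL2).const_mul _) fun ω => ?_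
      rw [← sq_abs, ← mul_pow]
      exact pow_le_pow_left₀ (abs_nonneg _) (abs_real_inner_le_norm _ _) 2
    rw [integral_const_mul] at hle
    have h0 : 0 ≤ ∫ ω, inner ℝ h (Y ω) ^ 2 ∂P := integral_nonneg fun ω => sq_nonneg _
    rw [Real.norm_eq_abs, Real.norm_eq_abs, abs_of_nonneg (by positivity),
      abs_of_nonneg (by positivity), hq]
    simp only
    linarith
  have h3 : (fun h => Φ h - 1) =O[𝓝 0] fun h => ‖h‖ ^ 2 := by
    simpa using h1.isBigO.add h2
  have h4 : Tendsto Φ (𝓝 0) (𝓝 1) := by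
    have : Tendsto (fun h => Φ h - 1) (𝓝 0) (𝓝 0) := by
      refine h3.trans_tendsto ?_
      simpa using hn0.pow 2
    simpa using this.add_const 1
  have h5 : (fun h => Real.log (Φ h) - (Φ h - 1)) =o[𝓝 0] fun h => ‖h‖ ^ 2 := by
    have hd := (Real.hasDerivAt_log one_ne_zero).isLittleO.comp_tendsto h4
    refine Asymptotics.IsLittleO.trans_isBigO ?_ h3
    simpa [Function.comp_def] using hd
  refine (h5.add h1).congr_left fun h => ?_
  ring

/-- The expected exponential loss `h ↦ 𝔼 exp ⟨h, Y - w⟩` is convex. -/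
theorem convexOn_integral_exp_inner (hYm : AEStronglyMeasurable Y P)
    (hY : ∀ c : ℝ, Integrable (fun ω => Real.exp (c * ‖Y ω‖)) P) (w : E) :
    ConvexOn ℝ Set.univ fun h : E => ∫ ω, Real.exp (inner ℝ h (Y ω - w)) ∂P := by
  refine ⟨convex_univ, fun x _ y _ a b ha hb hab => ?_⟩
  have hx := integrable_exp_inner_sub hYm hY x w
  have hy := integrable_exp_inner_sub hYm hY y w
  simp only [smul_eq_mul]
  rw [← integral_const_mul, ← integral_const_mul, ← integral_add (hx.const_mul a) (hy.const_mul b)]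
  refine integral_mono (integrable_exp_inner_sub hYm hY _ w)
    ((hx.const_mul a).add (hy.const_mul b)) fun ω => ?_
  simp only [inner_add_left, real_inner_smul_left]
  exact convexOn_exp.2 (Set.mem_univ _) (Set.mem_univ _) ha hb hab

/-- If `Y` is non-degenerate, `h ↦ 𝔼 exp ⟨h, Y - w⟩` has at most one minimizer. -/
theorem minimizer_unique [IsProbabilityMeasure P]
    (hYm : AEStronglyMeasurable Y P)
    (hY : ∀ c : ℝ, Integrable (fun ω => Real.exp (c * ‖Y ω‖)) P)
    (hmean : ∀ h, ∫ ω, inner ℝ h (Y ω) ∂P = 0)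
    (hpos : ∀ h, h ≠ 0 → 0 < ∫ ω, inner ℝ h (Y ω) ^ 2 ∂P) {w x y : E}
    (hx : ∀ z, ∫ ω, Real.exp (inner ℝ x (Y ω - w)) ∂P ≤ ∫ ω, Real.exp (inner ℝ z (Y ω - w)) ∂P)
    (hy : ∀ z, ∫ ω, Real.exp (inner ℝ y (Y ω - w)) ∂P ≤ ∫ ω, Real.exp (inner ℝ z (Y ω - w)) ∂P) :
    x = y := by
  set m : E := (1 / 2 : ℝ) • (x + y) with hm
  have hix := integrable_exp_inner_sub hYm hY x w
  have hiy := integrable_exp_inner_sub hYm hY y w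
  have him := integrable_exp_inner_sub hYm hY m w
  -- at the midpoint `m`, the defect `D` in the convexity inequality is a square that has mean zero
  set D : Ω → ℝ := fun ω => Real.exp (inner ℝ x (Y ω - w)) + Real.exp (inner ℝ y (Y ω - w)) -
    2 * Real.exp (inner ℝ m (Y ω - w)) with hD
  have hDsq : ∀ ω, D ω = (Real.exp (inner ℝ x (Y ω - w) / 2) -
      Real.exp (inner ℝ y (Y ω - w) / 2)) ^ 2 := by
    intro ω
    have e1 : Real.exp (inner ℝ m (Y ω - w)) =
        Real.exp (inner ℝ x (Y ω - w) / 2) * Real.exp (inner ℝ y (Y ω - w) / 2) := by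
      rw [← Real.exp_add, hm, real_inner_smul_left, inner_add_left]; ring_nf
    have e2 : ∀ t : ℝ, Real.exp t = Real.exp (t / 2) ^ 2 := fun t => by
      rw [← Real.exp_nat_mul]; push_cast; ring_nf
    rw [hD]
    simp only
    rw [e1, e2 (inner ℝ x (Y ω - w)), e2 (inner ℝ y (Y ω - w))]
    ring
  have hDi : Integrable D P := (hix.add hiy).sub (him.const_mul 2)
  have hD0 : 0 ≤ D := fun ω => by rw [hDsq]; exact sq_nonneg _
  have hDint : ∫ ω, D ω ∂P = 0 := by
    refine le_antisymm ?_ (integral_nonneg hD0)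
    have e : ∫ ω, D ω ∂P = ∫ ω, Real.exp (inner ℝ x (Y ω - w)) ∂P +
        ∫ ω, Real.exp (inner ℝ y (Y ω - w)) ∂P - 2 * ∫ ω, Real.exp (inner ℝ m (Y ω - w)) ∂P := by
      have hixy : Integrable (fun ω => Real.exp (inner ℝ x (Y ω - w)) +
        Real.exp (inner ℝ y (Y ω - w))) P := hix.add hiy
      rw [← integral_const_mul, ← integral_add hix hiy, ← integral_sub hixy (him.const_mul 2)]
    rw [e]
    linarith [hx m, hy m]
  have hae := (integral_eq_zero_iff_of_nonneg hD0 hDi).1 hDint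
  by_contra hne
  have hlin : ∀ᵐ ω ∂P, inner ℝ (x - y) (Y ω) = inner ℝ (x - y) w := by
    filter_upwards [hae] with ω hω
    rw [hDsq] at hω
    have h1 : Real.exp (inner ℝ x (Y ω - w) / 2) = Real.exp (inner ℝ y (Y ω - w) / 2) :=
      sub_eq_zero.1 (pow_eq_zero_iff two_ne_zero |>.1 hω)
    have h2 := Real.exp_injective h1
    rw [inner_sub_right, inner_sub_right] at h2
    rw [inner_sub_left, inner_sub_left]
    linarith
  have hw : inner ℝ (x - y) w = 0 := by
    have := integral_congr_ae hlin
    rw [hmean] at this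
    simpa using this.symm
  have hz : ∫ ω, inner ℝ (x - y) (Y ω) ^ 2 ∂P = 0 := by
    rw [← integral_zero Ω ℝ (μ := P)]
    refine integral_congr_ae ?_
    filter_upwards [hlin] with ω hω
    rw [hω, hw]; simp
  exact (hpos _ (sub_ne_zero.2 hne)).ne' hz

theorem integral_exp_inner_sub_eq (w h : E) :
    ∫ ω, Real.exp (inner ℝ h (Y ω - w)) ∂P =
      Real.exp (-inner ℝ h w) * ∫ ω, Real.exp (inner ℝ h (Y ω)) ∂P := by
  rw [← integral_const_mul]
  refine integral_congr_ae (ae_of_all _ fun ω => ?_)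
  simp only [inner_sub_right, ← Real.exp_add]
  ring_nf

end Laplace

/-! ### Perturbed quadratic forms -/

/-- If `ψ` agrees with the quadratic form `⟨h, Q h⟩ / 2` to second order at the origin, then
`h ↦ ψ h - ⟨h, W / √N⟩` is larger on the sphere of radius `ρ / √N` around the minimizer
`Q⁻¹ W / √N` of its quadratic approximation than at that point, uniformly for bounded `W`. -/
theorem eventually_lt_on_sphere {E : Type*} [NormedAddCommGroup E] [InnerProductSpace ℝ E]
    {ψ : E → ℝ} {Q Qinv : E →L[ℝ] E} {κ : ℝ} (hκ : 0 < κ)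
    (hψ : (fun h => ψ h - inner ℝ h (Q h) / 2) =o[𝓝 0] fun h => ‖h‖ ^ 2)
    (hsymm : ∀ x y, inner ℝ x (Q y) = inner ℝ (Q x) y)
    (hQ : ∀ h, κ * ‖h‖ ^ 2 ≤ inner ℝ h (Q h)) (hinv : ∀ u, Q (Qinv u) = u)
    {ρ : ℝ} (hρ : 0 < ρ) (L : ℝ) :
    ∀ᶠ N : ℕ in atTop, ∀ W : E, ‖W‖ ≤ L → ∀ h : E,
      ‖h - (√(N : ℝ))⁻¹ • Qinv W‖ = (√(N : ℝ))⁻¹ * ρ →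
      ψ ((√(N : ℝ))⁻¹ • Qinv W) - inner ℝ ((√(N : ℝ))⁻¹ • Qinv W) ((√(N : ℝ))⁻¹ • W) <
        ψ h - inner ℝ h ((√(N : ℝ))⁻¹ • W) := by
  set R : ℝ := ‖Qinv‖ * |L| + ρ with hR
  have hR0 : 0 < R := by positivity
  set η : ℝ := κ * ρ ^ 2 / (8 * R ^ 2) with hη
  have hη0 : 0 < η := by positivity
  obtain ⟨δ, hδ, hball⟩ := Metric.eventually_nhds_iff_ball.1 (hψ.def hη0)
  have hlim : Tendsto (fun N : ℕ => (√(N : ℝ))⁻¹ * R) atTop (𝓝 0) := by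
    simpa using (tendsto_inv_atTop_zero.comp
      (Real.tendsto_sqrt_atTop.comp tendsto_natCast_atTop_atTop)).mul_const R
  filter_upwards [hlim.eventually_lt_const hδ, eventually_gt_atTop 0] with N hN hN0 W hW h hh
  set s : ℝ := (√(N : ℝ))⁻¹ with hs
  have hs0 : 0 < s := by
    have : (0 : ℝ) < N := by exact_mod_cast hN0
    positivity
  set c : E := s • Qinv W with hc
  have hQW : ‖Qinv W‖ ≤ ‖Qinv‖ * |L| :=
    (Qinv.le_opNorm W).trans (by gcongr; exact hW.trans (le_abs_self L))
  have hcn : ‖c‖ ≤ s * R := by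
    rw [hc, norm_smul, Real.norm_of_nonneg hs0.le]
    gcongr
    linarith
  have hhn : ‖h‖ ≤ s * R := by
    have h1 : ‖h‖ ≤ ‖h - c‖ + ‖c‖ := by simpa using norm_add_le (h - c) c
    have h2 : ‖c‖ ≤ s * (‖Qinv‖ * |L|) := by
      rw [hc, norm_smul, Real.norm_of_nonneg hs0.le]; gcongr
    rw [hh] at h1
    calc _ ≤ _ := h1
      _ ≤ s * ρ + s * (‖Qinv‖ * |L|) := by gcongr
      _ = _ := by rw [hR]; ring
  have hsmall : ∀ y : E, ‖y‖ ≤ s * R → |ψ y - inner ℝ y (Q y) / 2| ≤ κ * ρ ^ 2 * s ^ 2 / 8 := by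
    intro y hy
    have h1 := hball y (by simpa using hy.trans_lt hN)
    rw [Real.norm_eq_abs, Real.norm_eq_abs, abs_of_nonneg (sq_nonneg ‖y‖)] at h1
    calc _ ≤ η * ‖y‖ ^ 2 := h1
      _ ≤ η * (s * R) ^ 2 := by gcongr
      _ = _ := by rw [hη]; field_simp
  have hw : s • W = Q c := by rw [hc, map_smul, hinv]
  rw [hw]
  -- completing the square
  have hsq : inner ℝ h (Q h) / 2 - inner ℝ h (Q c) - (inner ℝ c (Q c) / 2 - inner ℝ c (Q c)) =
      inner ℝ (h - c) (Q (h - c)) / 2 := by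
    rw [map_sub, inner_sub_left, inner_sub_right, inner_sub_right, hsymm c h,
      real_inner_comm h (Q c)]
    ring
  have h1 := hQ (h - c)
  rw [hh] at h1
  have h2 := abs_le.1 (hsmall h hhn)
  have h3 := abs_le.1 (hsmall c hcn)
  have h4 : 0 < κ * ρ ^ 2 * s ^ 2 := by positivity
  have h5 : κ * (s * ρ) ^ 2 = κ * ρ ^ 2 * s ^ 2 := by ring
  linarith

/-! ### The multivariate central limit theorem and Gaussian tails -/

theorem charFun_map_eq_charFun_map_inner_one {Ω E : Type*} [MeasurableSpace Ω]
    [NormedAddCommGroup E] [InnerProductSpace ℝ E] [MeasurableSpace E] [BorelSpace E]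
    [SecondCountableTopology E] {P : Measure Ω} {X : Ω → E} (hX : AEMeasurable X P) (t : E) :
    charFun (P.map X) t = charFun (P.map fun ω => inner ℝ t (X ω)) 1 := by
  rw [charFun_apply, charFun_apply, integral_map hX (by fun_prop),
    integral_map (hX.const_inner) (by fun_prop)]
  simp [real_inner_comm]

/-- The multivariate central limit theorem, for centred random vectors. -/
theorem tendstoInDistribution_inv_sqrt_smul_sum {Ω ι : Type*} [MeasurableSpace Ω] [Fintype ι]
    [DecidableEq ι] {P : Measure Ω} [IsProbabilityMeasure P] {Y : ℕ → Ω → EuclideanSpace ℝ ι}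
    (hL2 : MemLp (Y 0) 2 P) (hindep : iIndepFun Y P) (hident : ∀ i, IdentDistrib (Y i) (Y 0) P P)
    (hmean : ∀ t, ∫ ω, inner ℝ t (Y 0 ω) ∂P = 0) {S : Matrix ι ι ℝ} (hS : S.PosSemidef)
    (hvar : ∀ t, Var[fun ω => inner ℝ t (Y 0 ω); P] =
      inner ℝ t (Matrix.toEuclideanCLM (𝕜 := ℝ) S t)) :
    TendstoInDistribution (fun (N : ℕ) ω => (√(N : ℝ))⁻¹ • ∑ k ∈ Finset.range N, Y k ω) atTop id
      (fun _ => P) (multivariateGaussian 0 S) where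
  forall_aemeasurable N := by
    have h := fun i => (hident i).aemeasurable_fst
    exact (Finset.aemeasurable_fun_sum (Finset.range N) fun i _ => h i).const_smul (√(N : ℝ))⁻¹
  tendsto := by
    have hm := fun i => (hident i).aemeasurable_fst
    have hsum : ∀ N : ℕ, AEMeasurable
        (fun ω => (√(N : ℝ))⁻¹ • ∑ k ∈ Finset.range N, Y k ω) P := fun N =>
      (Finset.aemeasurable_fun_sum (Finset.range N) fun i _ => hm i).const_smul (√(N : ℝ))⁻¹
    -- the characteristic function at `t` is that of the scalar projection on `t` at `1`
    refine ProbabilityMeasure.tendsto_iff_tendsto_charFun.2 fun t => ?_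
    have hmeas : Measurable fun y : EuclideanSpace ℝ ι => (inner ℝ t y : ℝ) := by fun_prop
    have hclt := tendstoInDistribution_inv_sqrt_mul_sum_sub (P := P)
      (X := fun k ω => (inner ℝ t (Y k ω) : ℝ))
      (P' := gaussianReal 0 Var[fun ω => inner ℝ t (Y 0 ω); P].toNNReal) (Y := id)
      ⟨aemeasurable_id, by simp⟩ (hL2.const_inner t) (hindep.comp _ fun _ => hmeas)
      (fun i => (hident i).comp hmeas)
    have h1 := ProbabilityMeasure.tendsto_iff_tendsto_charFun.1 hclt.tendsto 1
    simp only [ProbabilityMeasure.coe_mk, Measure.map_id] at h1 ⊢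
    rw [charFun_gaussianReal] at h1
    rw [charFun_multivariateGaussian hS]
    convert h1 using 2 with N
    · rw [charFun_map_eq_charFun_map_inner_one (hsum N)]
      simp only [hmean, mul_zero, sub_zero, inner_smul_right, inner_sum]
    · have hv := variance_nonneg (fun ω => (inner ℝ t (Y 0 ω) : ℝ)) P
      rw [Real.coe_toNNReal _ hv, hvar, Matrix.inner_toEuclideanCLM]
      simp

theorem integrable_norm_sq_multivariateGaussian {ι : Type*} [Fintype ι] [DecidableEq ι]
    (S : Matrix ι ι ℝ) : Integrable (fun z => ‖z‖ ^ 2) (multivariateGaussian 0 S) :=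
  (memLp_two_iff_integrable_sq_norm (by fun_prop)).1 IsGaussian.memLp_two_id

theorem integral_norm_sq_multivariateGaussian {ι : Type*} [Fintype ι] [DecidableEq ι]
    {S : Matrix ι ι ℝ} (hS : S.PosSemidef) :
    ∫ z, ‖z‖ ^ 2 ∂multivariateGaussian 0 S = S.trace := by
  have hL2 : MemLp id 2 (multivariateGaussian (0 : EuclideanSpace ℝ ι) S) :=
    IsGaussian.memLp_two_id
  have hc (i : ι) : MemLp (fun z : EuclideanSpace ℝ ι => z i) 2 (multivariateGaussian 0 S) :=
    hL2.continuousLinearMap_comp (EuclideanSpace.proj i : EuclideanSpace ℝ ι →L[ℝ] ℝ)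
  have h0 (i : ι) : ∫ z : EuclideanSpace ℝ ι, z i ∂multivariateGaussian 0 S = 0 := by
    have h := (EuclideanSpace.proj i : EuclideanSpace ℝ ι →L[ℝ] ℝ).integral_comp_comm
      (hL2.integrable one_le_two)
    simpa using h
  simp only [EuclideanSpace.real_norm_sq_eq]
  rw [integral_finsetSum _ fun i _ => (hc i).integrable_sq]
  refine Finset.sum_congr rfl fun i _ => ?_
  have h := variance_eval_multivariateGaussian (μ := 0) hS i
  rw [variance_eq_integral (hc i).aemeasurable, h0] at h
  simpa using h

theorem mul_measureReal_le_norm_multivariateGaussian {ι : Type*} [Fintype ι] [DecidableEq ι]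
    {S : Matrix ι ι ℝ} (hS : S.PosSemidef) {a : ℝ} (ha : 0 ≤ a) :
    a ^ 2 * (multivariateGaussian 0 S).real {z | a ≤ ‖z‖} ≤ S.trace := by
  rw [← integral_norm_sq_multivariateGaussian hS]
  have h := mul_meas_ge_le_integral_of_nonneg (μ := multivariateGaussian 0 S)
    (ae_of_all _ fun z => sq_nonneg ‖z‖) (integrable_norm_sq_multivariateGaussian S) (a ^ 2)
  refine le_trans (le_of_eq ?_) h
  congr 2
  ext z
  exact (pow_le_pow_iff_left₀ ha (norm_nonneg z) two_ne_zero).symm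

/-- Upper tails of a sequence that converges in distribution, by the portmanteau theorem. -/
theorem eventually_measure_le_norm_lt {E Ω' : Type*} [NormedAddCommGroup E] [MeasurableSpace E]
    [BorelSpace E] {Ω : ℕ → Type*} {m : ∀ i, MeasurableSpace (Ω i)} {μ : (i : ℕ) → Measure (Ω i)}
    [∀ i, IsProbabilityMeasure (μ i)] [MeasurableSpace Ω'] {ν : Measure Ω'}
    [IsProbabilityMeasure ν] {X : (i : ℕ) → Ω i → E} {Z : Ω' → E}
    (h : TendstoInDistribution X atTop Z μ ν) {a : ℝ} {η : ENNReal}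
    (hη : ν {z | a ≤ ‖Z z‖} < η) : ∀ᶠ N in atTop, μ N {ω | a ≤ ‖X N ω‖} < η := by
  have hF : IsClosed {z : E | a ≤ ‖z‖} := isClosed_le continuous_const continuous_norm
  have h1 := ProbabilityMeasure.limsup_measure_closed_le_of_tendsto h.tendsto hF
  simp only [ProbabilityMeasure.coe_mk] at h1
  rw [Measure.map_apply_of_aemeasurable h.aemeasurable_limit hF.measurableSet] at h1
  filter_upwards [eventually_lt_of_limsup_lt (h1.trans_lt hη)] with N hN
  rwa [Measure.map_apply_of_aemeasurable (h.forall_aemeasurable N) hF.measurableSet] at hN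

/-! ### Independent samples and the score -/

/-- The distribution of an infinite sequence of independent samples from `law θ`. -/
def pathLaw (θ : Param n d) : Measure (ℕ → Fin n → ℝ) := Measure.infinitePi fun _ => law θ

instance isProbabilityMeasure_pathLaw [Fact (Odd d)] (θ : Param n d) :
    IsProbabilityMeasure (pathLaw θ) := by
  unfold pathLaw; infer_instance

theorem map_eval_pathLaw [Fact (Odd d)] (θ : Param n d) (k : ℕ) :
    (pathLaw θ).map (fun ω => ω k) = law θ :=
  Measure.infinitePi_map_eval (fun _ => law θ) k

theorem iIndepFun_eval_pathLaw [Fact (Odd d)] (θ : Param n d) :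
    iIndepFun (fun (k : ℕ) (ω : ℕ → Fin n → ℝ) => ω k) (pathLaw θ) := by
  rw [iIndepFun_iff_map_fun_eq_infinitePi_map fun i => measurable_pi_apply i]
  simp only [map_eval_pathLaw]
  exact Measure.map_id

/-- The first `N` samples of a sequence. -/
def firstSamples (N : ℕ) (ω : ℕ → Fin n → ℝ) : Fin N → Fin n → ℝ := fun k => ω k

theorem measurable_firstSamples (N : ℕ) :
    Measurable (firstSamples N : (ℕ → Fin n → ℝ) → Fin N → Fin n → ℝ) :=
  measurable_pi_iff.2 fun k => measurable_pi_apply (k : ℕ)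

theorem map_firstSamples_pathLaw [Fact (Odd d)] (θ : Param n d) (N : ℕ) :
    (pathLaw θ).map (firstSamples N) = sampleLaw θ N := by
  have h := ((iIndepFun_eval_pathLaw θ).precomp
    (Fin.val_injective : Function.Injective (Fin.val : Fin N → ℕ))).map_fun_eq_pi_map
    fun k => (measurable_pi_apply _).aemeasurable
  simp only [map_eval_pathLaw] at h
  exact h

/-- Convergence in distribution of functions of the first `N` terms of an infinite sample. Slutsky's
theorem requires a single probability space, which the infinite product provides. -/
theorem tendstoInDistribution_sampleLaw [Fact (Odd d)] {E Ω' : Type*} [TopologicalSpace E]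
    [MeasurableSpace E] [OpensMeasurableSpace E] [MeasurableSpace Ω'] {ν : Measure Ω'}
    [IsProbabilityMeasure ν] {Z : Ω' → E} {θ : Param n d}
    {f : (N : ℕ) → (Fin N → Fin n → ℝ) → E} (hf : ∀ N, Measurable (f N))
    (h : TendstoInDistribution (fun N ω => f N (firstSamples N ω)) atTop Z (fun _ => pathLaw θ) ν) :
    TendstoInDistribution f atTop Z (sampleLaw θ) ν where
  forall_aemeasurable N := (hf N).aemeasurable
  aemeasurable_limit := h.aemeasurable_limit
  tendsto := by
    refine h.tendsto.congr fun N => Subtype.ext ?_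
    change (pathLaw θ).map (f N ∘ firstSamples N) = (sampleLaw θ N).map (f N)
    rw [← map_firstSamples_pathLaw, Measure.map_map (hf N) (measurable_firstSamples N)]

/-- The normalized score `N^(-1/2) ∑ (T(xₖ) - 𝔼 T)` of the samples `x` at the parameter `θ`. -/
def score (θ : Param n d) {N : ℕ} (x : Fin N → Fin n → ℝ) : Param n d :=
  (√(N : ℝ))⁻¹ • ∑ k, (suffStat d (x k) - meanStat θ)

theorem continuous_score (θ : Param n d) (N : ℕ) :
    Continuous (score θ : (Fin N → Fin n → ℝ) → Param n d) := by
  have := continuous_suffStat (n := n) (d := d)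
  unfold score
  fun_prop

theorem inner_fisherOp_comm (θ x y : Param n d) :
    inner ℝ x (fisherOp θ y) = inner ℝ (fisherOp θ x) y := by
  rw [real_inner_comm y, fisherOp, Matrix.inner_toEuclideanCLM, Matrix.inner_toEuclideanCLM,
    Matrix.dotProduct_mulVec, ← Matrix.mulVec_transpose, dotProduct_comm]
  have := fisherInfo_isHermitian θ
  rw [Matrix.IsHermitian, Matrix.conjTranspose_eq_transpose_of_trivial] at this
  rw [this]

/-- Asymptotic normality of the score, transported by the inverse Fisher information. -/
theorem tendstoInDistribution_fisherOpInv_score [Fact (Odd d)] {θ : Param n d}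
    (hF : (fisherInfo θ).PosDef) :
    TendstoInDistribution (fun N ω => fisherOpInv θ (score θ (firstSamples N ω))) atTop id
      (fun _ => pathLaw θ) (multivariateGaussian 0 (fisherInfo θ)⁻¹) := by
  have hT := continuous_suffStat (n := n) (d := d)
  set g : (Fin n → ℝ) → Param n d := fun x => fisherOpInv θ (suffStat d x - meanStat θ) with hg
  have hgm : Measurable g := by
    have : Continuous g := by fun_prop
    exact this.measurable
  have hsymm (x y : Param n d) : inner ℝ x (fisherOpInv θ y) = inner ℝ (fisherOpInv θ x) y := by
    conv_lhs => rw [← fisherOp_fisherOpInv hF x]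
    rw [← inner_fisherOp_comm, fisherOp_fisherOpInv hF]
  have hlaw (f : (Fin n → ℝ) → ℝ) (hf : Continuous f) :
      ∫ ω, f (ω 0) ∂pathLaw θ = ∫ x, f x ∂law θ := by
    rw [← map_eval_pathLaw θ 0, integral_map (measurable_pi_apply 0).aemeasurable
      hf.aestronglyMeasurable]
  have hmemT : MemLp (fun x => suffStat d x - meanStat θ) 2 (law θ) :=
    (memLp_suffStat θ).sub (memLp_const _)
  have hmean (t : Param n d) : ∫ x, inner ℝ t (suffStat d x - meanStat θ) ∂law θ = 0 := by
    simp only [inner_sub_right]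
    rw [integral_sub (((memLp_suffStat θ).const_inner t).integrable one_le_two)
      (integrable_const _), ← inner_meanStat]
    simp
  have key := tendstoInDistribution_inv_sqrt_smul_sum (P := pathLaw θ)
    (Y := fun k ω => g (ω k)) ?_ ((iIndepFun_eval_pathLaw θ).comp _ fun _ => hgm)
    (fun i => ?_) (fun t => ?_) hF.inv.posSemidef (fun t => ?_)
  · refine key.congr (fun N => ae_of_all _ fun ω => ?_) (ae_of_all _ fun _ => rfl)
    simp only [score, hg, firstSamples, map_smul, map_sum]
    rw [Finset.sum_range]
  · have h : MemLp g 2 (law θ) := (fisherOpInv θ).comp_memLp' hmemT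
    rw [← map_eval_pathLaw θ 0] at h
    exact h.comp_of_map (measurable_pi_apply 0).aemeasurable
  · have hid : IdentDistrib (fun ω : ℕ → Fin n → ℝ => ω i) (fun ω => ω 0) (pathLaw θ)
        (pathLaw θ) := ⟨(measurable_pi_apply i).aemeasurable,
      (measurable_pi_apply 0).aemeasurable, by rw [map_eval_pathLaw, map_eval_pathLaw]⟩
    exact hid.comp hgm
  · rw [hlaw (fun x => inner ℝ t (g x)) (by fun_prop)]
    simp only [hg, hsymm, hmean]
  · have h0 : ∫ ω, inner ℝ t (g (ω 0)) ∂pathLaw θ = 0 := by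
      rw [hlaw (fun x => inner ℝ t (g x)) (by fun_prop)]
      simp only [hg, hsymm, hmean]
    rw [variance_eq_integral (Continuous.aemeasurable (by fun_prop)), h0]
    simp only [sub_zero]
    rw [hlaw (fun x => inner ℝ t (g x) ^ 2) (by fun_prop)]
    simp only [hg, hsymm]
    rw [← inner_fisherOp_eq_integral, fisherOp_fisherOpInv hF, ← hsymm]
    rfl

/-! ### The likelihood as an exponential loss -/

/-- The sufficient statistics, centred at their mean under `law θ`. -/
def centredStat (θ : Param n d) (x : Fin n → ℝ) : Param n d := suffStat d x - meanStat θ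

theorem continuous_centredStat (θ : Param n d) : Continuous (centredStat θ) :=
  continuous_suffStat.sub continuous_const

theorem integrable_exp_norm_centredStat [Fact (Odd d)] (θ : Param n d) (c : ℝ) :
    Integrable (fun x => Real.exp (c * ‖centredStat θ x‖)) (law θ) := by
  have hcont := continuous_centredStat θ
  refine ((integrable_exp_norm_suffStat θ |c|).const_mul (Real.exp (|c| * ‖meanStat θ‖))).mono'
    (Continuous.aestronglyMeasurable (by fun_prop)) (ae_of_all _ fun x => ?_)
  rw [Real.norm_eq_abs, Real.abs_exp, ← Real.exp_add, Real.exp_le_exp]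
  calc _ ≤ |c| * (‖suffStat d x‖ + ‖meanStat θ‖) := by
        gcongr
        exacts [le_abs_self c, norm_sub_le _ _]
    _ = _ := by ring

theorem integral_inner_centredStat [Fact (Odd d)] (θ h : Param n d) :
    ∫ x, inner ℝ h (centredStat θ x) ∂law θ = 0 := by
  simp only [centredStat, inner_sub_right]
  rw [integral_sub (((memLp_suffStat θ).const_inner h).integrable one_le_two)
    (integrable_const _), ← inner_meanStat]
  simp

/-- The expected exponential loss `𝔼 exp ⟨h, T - 𝔼 T - w⟩` under `law θ`. If `w` is the deviation
of the empirical mean of the sufficient statistics, it is the ratio of the geometric means of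
the likelihoods of `θ` and `θ + h`. -/
def expLoss (θ w h : Param n d) : ℝ := ∫ x, Real.exp (inner ℝ h (centredStat θ x - w)) ∂law θ

theorem expLoss_pos [Fact (Odd d)] (θ w h : Param n d) : 0 < expLoss θ w h :=
  integral_exp_pos (integrable_exp_inner_sub (continuous_centredStat θ).aestronglyMeasurable
    (integrable_exp_norm_centredStat θ) h w)

theorem partitionFn_add [Fact (Odd d)] (θ w h : Param n d) :
    partitionFn (θ + h) =
      Real.exp (inner ℝ h (meanStat θ + w)) * expLoss θ w h * partitionFn θ := by
  rw [expLoss, ← integral_const_mul, integral_law, div_mul_cancel₀ _ (partitionFn_pos θ).ne',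
    partitionFn]
  refine integral_congr_ae (ae_of_all _ fun x => ?_)
  simp only
  rw [weight_add, ← Real.exp_add, ← inner_add_right, centredStat]
  congr 3
  abel

theorem log_density_add [Fact (Odd d)] (θ w h : Param n d) (x : Fin n → ℝ) :
    Real.log (density (θ + h) x) =
      Real.log (density θ x) + inner ℝ h (centredStat θ x - w) - Real.log (expLoss θ w h) := by
  have h1 := weight_pos θ x
  have h2 := partitionFn_pos θ
  have h3 := expLoss_pos θ w h
  have e : density (θ + h) x =
      density θ x * Real.exp (inner ℝ h (centredStat θ x - w)) / expLoss θ w h := by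
    have e1 : Real.exp (inner ℝ h (suffStat d x)) = Real.exp (inner ℝ h (meanStat θ + w)) *
        Real.exp (inner ℝ h (centredStat θ x - w)) := by
      rw [← Real.exp_add, ← inner_add_right, centredStat]
      congr 2
      abel
    rw [density, density, partitionFn_add θ w h, weight_add, e1]
    have := (Real.exp_pos (inner ℝ h (meanStat θ + w))).ne'
    field_simp
  have h4 : 0 < density θ x := div_pos h1 h2
  rw [e, Real.log_div (mul_pos h4 (Real.exp_pos _)).ne' h3.ne',
    Real.log_mul h4.ne' (Real.exp_pos _).ne', Real.log_exp]

theorem logLik_add [Fact (Odd d)] {N : ℕ} (hN : 0 < N) (θ h : Param n d)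
    (x : Fin N → Fin n → ℝ) :
    logLik x (θ + h) =
      logLik x θ - Real.log (expLoss θ ((√(N : ℝ))⁻¹ • score θ x) h) := by
  have hN' : (0 : ℝ) < N := by exact_mod_cast hN
  set w := (√(N : ℝ))⁻¹ • score θ x with hw
  have hw' : w = (N : ℝ)⁻¹ • ∑ k, centredStat θ (x k) := by
    rw [hw, score, smul_smul, ← mul_inv, Real.mul_self_sqrt hN'.le]
    rfl
  have hsum : ∑ k, inner ℝ h (centredStat θ (x k) - w) = (0 : ℝ) := by
    rw [← inner_sum, Finset.sum_sub_distrib, Finset.sum_const, Finset.card_univ, Fintype.card_fin,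
      hw', ← Nat.cast_smul_eq_nsmul ℝ, smul_inv_smul₀ hN'.ne', sub_self, inner_zero_right]
  rw [logLik, logLik]
  simp only [log_density_add θ w h]
  rw [Finset.sum_sub_distrib, Finset.sum_add_distrib, hsum, Finset.sum_const, Finset.card_univ,
    Fintype.card_fin, nsmul_eq_mul]
  field_simp
  ring

theorem isMaxLik_add_iff [Fact (Odd d)] {N : ℕ} (hN : 0 < N) (θ h : Param n d)
    (x : Fin N → Fin n → ℝ) :
    IsMaxLik x (θ + h) ↔ ∀ z, expLoss θ ((√(N : ℝ))⁻¹ • score θ x) h ≤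
      expLoss θ ((√(N : ℝ))⁻¹ • score θ x) z := by
  have key (z : Param n d) : logLik x (θ + z) ≤ logLik x (θ + h) ↔
      expLoss θ ((√(N : ℝ))⁻¹ • score θ x) h ≤ expLoss θ ((√(N : ℝ))⁻¹ • score θ x) z := by
    rw [logLik_add hN, logLik_add hN, sub_le_sub_iff_left,
      Real.log_le_log_iff (expLoss_pos _ _ _) (expLoss_pos _ _ _)]
  refine ⟨fun hm z => (key z).1 (hm _), fun hm θ' => ?_⟩
  have := (key (θ' - θ)).2 (hm _)
  rwa [add_sub_cancel] at this

/-! ### Asymptotics of the maximum likelihood estimator -/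

/-- For many samples with bounded score, the maximum likelihood estimate exists, is unique, and
its rescaled error is close to the image of the score under the inverse Fisher information. -/
theorem eventually_existsUnique_isMaxLik [Fact (Odd d)] {θ : Param n d} {κ : ℝ} (hκ : 0 < κ)
    (hF : (fisherInfo θ).PosDef) (hQ : ∀ h, κ * ‖h‖ ^ 2 ≤ inner ℝ h (fisherOp θ h))
    {ρ : ℝ} (hρ : 0 < ρ) (L : ℝ) :
    ∀ᶠ N : ℕ in atTop, ∀ x : Fin N → Fin n → ℝ, ‖score θ x‖ ≤ L →
      (∃! θ' : Param n d, IsMaxLik x θ') ∧ ∀ θ' : Param n d, IsMaxLik x θ' →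
        ‖√(N : ℝ) • (θ' - θ) - fisherOpInv θ (score θ x)‖ ≤ ρ := by
  have hYm : AEStronglyMeasurable (centredStat θ) (law θ) :=
    (continuous_centredStat θ).aestronglyMeasurable
  have hY := integrable_exp_norm_centredStat θ
  have hmean := integral_inner_centredStat θ
  have hq (h : Param n d) :
      ∫ x, inner ℝ h (centredStat θ x) ^ 2 ∂law θ = inner ℝ h (fisherOp θ h) :=
    (inner_fisherOp_eq_integral θ h).symm
  have hψ := log_laplace_sub_quadratic_isLittleO hYm hY hmean
  simp only [hq] at hψ
  have hpos (h : Param n d) (h0 : h ≠ 0) : 0 < ∫ x, inner ℝ h (centredStat θ x) ^ 2 ∂law θ := by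
    rw [hq]
    exact lt_of_lt_of_le (by positivity) (hQ h)
  filter_upwards [eventually_lt_on_sphere hκ hψ (inner_fisherOp_comm θ) hQ
    (fisherOp_fisherOpInv hF) hρ L, eventually_gt_atTop 0] with N hN hN0 x hx
  have hN' : (0 : ℝ) < N := by exact_mod_cast hN0
  set s : ℝ := (√(N : ℝ))⁻¹ with hs
  have hs0 : 0 < s := by positivity
  set w := s • score θ x with hw
  have hG := convexOn_integral_exp_inner hYm hY w
  have hmin := exists_minimizer_and_norm_sub_le hG (c := s • fisherOpInv θ (score θ x))
    (mul_pos hs0 hρ) fun h hh => by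
      have hΦ (z : Param n d) : 0 < ∫ x, Real.exp (inner ℝ z (centredStat θ x)) ∂law θ :=
        integral_exp_pos (integrable_exp_inner hYm hY z)
      have h1 := hN (score θ x) hx h hh
      rw [integral_exp_inner_sub_eq, integral_exp_inner_sub_eq, ← Real.exp_log (hΦ h),
        ← Real.exp_log (hΦ (s • fisherOpInv θ (score θ x))), ← Real.exp_add, ← Real.exp_add,
        Real.exp_lt_exp]
      linarith
  obtain ⟨⟨y, hy⟩, hnear⟩ := hmin
  have hshift (θ' : Param n d) : θ' = θ + (θ' - θ) := (add_sub_cancel θ θ').symm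
  refine ⟨⟨θ + y, (isMaxLik_add_iff hN0 θ y x).2 hy, fun θ' hθ' => ?_⟩, fun θ' hθ' => ?_⟩
  · rw [hshift θ', isMaxLik_add_iff hN0] at hθ'
    rw [hshift θ', minimizer_unique hYm hY hmean hpos hθ' hy]
  · rw [hshift θ', isMaxLik_add_iff hN0] at hθ'
    have h1 := hnear _ hθ'
    have h2 : θ' - θ - s • fisherOpInv θ (score θ x) =
        s • (√(N : ℝ) • (θ' - θ) - fisherOpInv θ (score θ x)) := by
      rw [smul_sub, hs, inv_smul_smul₀ (by positivity)]
    rw [h2, norm_smul, Real.norm_of_nonneg hs0.le] at h1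
    exact le_of_mul_le_mul_left h1 hs0

/-- The score is bounded in probability. -/
theorem exists_eventually_sampleLaw_score_lt [Fact (Odd d)] {θ : Param n d}
    (hF : (fisherInfo θ).PosDef) {η : ENNReal} (hη : 0 < η) :
    ∃ L : ℝ, ∀ᶠ N : ℕ in atTop,
      sampleLaw θ N {x | ¬ ‖score θ x‖ ≤ L} < η := by
  have hS := hF.inv.posSemidef
  have hclt := tendstoInDistribution_sampleLaw
    (fun N => (fisherOpInv θ).continuous.measurable.comp (continuous_score θ N).measurable)
    (tendstoInDistribution_fisherOpInv_score hF)
  obtain ⟨a, ha0, ha⟩ : ∃ a : ℝ, 0 ≤ a ∧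
      multivariateGaussian 0 (fisherInfo θ)⁻¹ {z | a ≤ ‖id z‖} < η := by
    rcases eq_or_ne η ⊤ with rfl | htop
    · exact ⟨0, le_rfl, measure_lt_top _ _⟩
    have hη' : 0 < η.toReal := ENNReal.toReal_pos hη.ne' htop
    have htr : 0 ≤ (fisherInfo θ)⁻¹.trace := hS.trace_nonneg
    refine ⟨√(((fisherInfo θ)⁻¹.trace + 1) / η.toReal), Real.sqrt_nonneg _, ?_⟩
    have h := mul_measureReal_le_norm_multivariateGaussian hS
      (Real.sqrt_nonneg (((fisherInfo θ)⁻¹.trace + 1) / η.toReal))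
    rw [Real.sq_sqrt (by positivity), div_mul_eq_mul_div, div_le_iff₀ hη'] at h
    rw [← ENNReal.toReal_lt_toReal (measure_ne_top _ _) htop]
    change (multivariateGaussian 0 (fisherInfo θ)⁻¹).real _ < _
    simp only [id_eq]
    have h0 : 0 ≤ (multivariateGaussian 0 (fisherInfo θ)⁻¹).real
      {z | √(((fisherInfo θ)⁻¹.trace + 1) / η.toReal) ≤ ‖z‖} := measureReal_nonneg
    by_contra! hcon
    nlinarith
  -- the tail bound for `I⁻¹ score` is transferred to the score by applying `I`
  refine ⟨‖fisherOp θ‖ * a, ?_⟩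
  filter_upwards [eventually_measure_le_norm_lt hclt ha] with N hN
  refine (measure_mono fun x hx => ?_).trans_lt hN
  simp only [Set.mem_ofPred_eq, not_le, Function.comp_apply] at hx ⊢
  by_contra! hcon
  have h1 : ‖score θ x‖ ≤ ‖fisherOp θ‖ * a := by
    conv_lhs => rw [← fisherOp_fisherOpInv hF (score θ x)]
    exact ((fisherOp θ).le_opNorm _).trans (by gcongr)
  linarith

theorem tendsto_sampleLaw_not_existsUnique [Fact (Odd d)] {θ : Param n d} {κ : ℝ} (hκ : 0 < κ)
    (hF : (fisherInfo θ).PosDef) (hQ : ∀ h, κ * ‖h‖ ^ 2 ≤ inner ℝ h (fisherOp θ h)) :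
    Tendsto (fun N : ℕ => sampleLaw θ N {x | ¬ ∃! θ' : Param n d, IsMaxLik x θ'}) atTop (𝓝 0) := by
  rw [ENNReal.tendsto_nhds_zero]
  intro η hη
  obtain ⟨L, hL⟩ := exists_eventually_sampleLaw_score_lt hF hη
  filter_upwards [hL, eventually_existsUnique_isMaxLik hκ hF hQ one_pos L] with N h1 h2
  refine (measure_mono fun x hx => ?_).trans h1.le
  exact fun hcon => hx (h2 x hcon).1

/-- Asymptotic normality of the maximum likelihood estimator. -/
theorem tendstoInDistribution_mle [Fact (Odd d)] {θ : Param n d} {κ : ℝ} (hκ : 0 < κ)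
    (hF : (fisherInfo θ).PosDef) (hQ : ∀ h, κ * ‖h‖ ^ 2 ≤ inner ℝ h (fisherOp θ h))
    {mle : (N : ℕ) → (Fin N → Fin n → ℝ) → Param n d} (hmle : ∀ N, IsMLE (mle N)) :
    TendstoInDistribution (fun (N : ℕ) x => √(N : ℝ) • (mle N x - θ)) atTop id
      (sampleLaw θ) (multivariateGaussian 0 (fisherInfo θ)⁻¹) := by
  have hmeas (N : ℕ) : Measurable fun x => √(N : ℝ) • (mle N x - θ) :=
    ((hmle N).measurable.sub_const θ).const_smul (√(N : ℝ))
  refine tendstoInDistribution_sampleLaw hmeas ?_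
  refine tendstoInDistribution_of_tendstoInMeasure_sub _ _
    (tendstoInDistribution_fisherOpInv_score hF) ?_
    fun N => ((hmeas N).comp (measurable_firstSamples N)).aemeasurable
  rw [tendstoInMeasure_iff_norm]
  intro ρ hρ
  rw [ENNReal.tendsto_nhds_zero]
  intro η hη
  obtain ⟨L, hL⟩ := exists_eventually_sampleLaw_score_lt hF hη
  filter_upwards [hL, eventually_existsUnique_isMaxLik hκ hF hQ (half_pos hρ) L] with N h1 h2
  have hms : MeasurableSet {x : Fin N → Fin n → ℝ | ¬ ‖score θ x‖ ≤ L} :=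
    (measurableSet_le (continuous_score θ N).norm.measurable measurable_const).compl
  rw [← map_firstSamples_pathLaw, Measure.map_apply (measurable_firstSamples N) hms] at h1
  refine (measure_mono fun ω hω hcon => ?_).trans h1.le
  obtain ⟨h3, h4⟩ := h2 _ hcon
  have h5 := h4 _ ((hmle N).isMaxLik _ h3.exists)
  simp only [Set.mem_ofPred_eq, Pi.sub_apply, Pi.zero_apply, sub_zero] at hω
  linarith

theorem trace_inv_le [hd : Fact (Odd d)] {B : ℝ} {θ : Param n d}
    (hn : 1 ≤ n) (hB : 1 ≤ B) (hθ : θ ∈ paramBall n d B) :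
    (fisherInfo θ)⁻¹.trace ≤ scaleParam n B ^ (3 * d) * scaleParam n B ^ (70 * d ^ 3) := by
  have hb := two_le_scaleParam n B
  have hdiag (m : MonoIdx n d) : (fisherInfo θ)⁻¹ m m ≤ scaleParam n B ^ (70 * d ^ 3) := by
    refine le_trans ?_ (opNorm_inv_le hn hB hθ)
    have h := Matrix.inner_toEuclideanCLM (fisherInfo θ)⁻¹ (EuclideanSpace.single m 1)
      (EuclideanSpace.single m 1)
    have e : (fisherInfo θ)⁻¹ m m = inner ℝ (EuclideanSpace.single m (1 : ℝ))
        (Matrix.toEuclideanCLM (𝕜 := ℝ) (fisherInfo θ)⁻¹ (EuclideanSpace.single m 1)) := by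
      rw [h]; simp
    rw [e]
    refine (real_inner_le_norm _ _).trans ?_
    refine (mul_le_mul_of_nonneg_left (ContinuousLinearMap.le_opNorm _ _)
      (norm_nonneg _)).trans (le_of_eq ?_)
    simp [opNorm]
  calc _ ≤ ∑ _m : MonoIdx n d, scaleParam n B ^ (70 * d ^ 3) := Finset.sum_le_sum fun m _ => hdiag m
    _ = Fintype.card (MonoIdx n d) * scaleParam n B ^ (70 * d ^ 3) := by simp
    _ ≤ _ := by gcongr; exact card_monoIdx_le_pow hn hB hd.out.pos

/-- The risk bound: the limit law has second moment `trace I⁻¹`, which is smaller than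
`b ^ (80 * d ^ 3)` by a factor of at least `128`. -/
theorem eventually_le_sampleLaw_mle [hd : Fact (Odd d)] {B : ℝ} {θ : Param n d}
    (hn : 1 ≤ n) (hB : 1 ≤ B) (hθ : θ ∈ paramBall n d B)
    {mle : (N : ℕ) → (Fin N → Fin n → ℝ) → Param n d} (hmle : ∀ N, IsMLE (mle N))
    (hclt : TendstoInDistribution (fun (N : ℕ) x => √(N : ℝ) • (mle N x - θ)) atTop id
      (sampleLaw θ) (multivariateGaussian 0 (fisherInfo θ)⁻¹)) :
    ∀ᶠ N : ℕ in atTop, 0.99 ≤ (sampleLaw θ N).real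
      {x | ‖mle N x - θ‖ ^ 2 ≤ scaleParam n B ^ (80 * d ^ 3) / N} := by
  have hb := two_le_scaleParam n B
  have hS := (fisherInfo_posDef hn hB hθ).inv.posSemidef
  have htr := trace_inv_le hn hB hθ
  have hd1 : 1 ≤ d := hd.out.pos
  set b := scaleParam n B
  set K := b ^ (80 * d ^ 3) with hK
  have hK0 : 0 < K := by positivity
  have hKtr : 128 * (b ^ (3 * d) * b ^ (70 * d ^ 3)) ≤ K := by
    calc _ ≤ b ^ 7 * (b ^ (3 * d) * b ^ (70 * d ^ 3)) := by
          gcongr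
          calc (128 : ℝ) = 2 ^ 7 := by norm_num
            _ ≤ _ := by gcongr
      _ = b ^ (7 + (3 * d + 70 * d ^ 3)) := by rw [pow_add, pow_add]
      _ ≤ _ := by
          refine pow_le_pow_right₀ (by linarith) ?_
          have : d ≤ d ^ 3 := Nat.le_self_pow three_ne_zero d
          omega
  have htail : multivariateGaussian 0 (fisherInfo θ)⁻¹ {z | √K ≤ ‖id z‖} <
      ENNReal.ofReal 0.01 := by
    have h := mul_measureReal_le_norm_multivariateGaussian hS (Real.sqrt_nonneg K)
    rw [Real.sq_sqrt hK0.le] at h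
    rw [← ofReal_measureReal, ENNReal.ofReal_lt_ofReal_iff (by norm_num)]
    simp only [id_eq]
    have h1 : K * (multivariateGaussian 0 (fisherInfo θ)⁻¹).real {z | √K ≤ ‖z‖} ≤
        K * (1 / 128) := by linarith
    exact (le_of_mul_le_mul_left h1 hK0).trans_lt (by norm_num)
  filter_upwards [eventually_measure_le_norm_lt hclt htail, eventually_gt_atTop 0] with N hN hN0
  have hN' : (0 : ℝ) < N := by exact_mod_cast hN0
  have hms : MeasurableSet {x | ‖mle N x - θ‖ ^ 2 ≤ K / N} :=
    measurableSet_le (((hmle N).measurable.sub_const θ).norm.pow_const 2) measurable_const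
  have hcompl : (sampleLaw θ N).real {x | ‖mle N x - θ‖ ^ 2 ≤ K / N}ᶜ ≤ 0.01 := by
    refine ENNReal.toReal_le_of_le_ofReal (by norm_num) ((measure_mono fun x hx => ?_).trans hN.le)
    simp only [Set.mem_compl_iff, Set.mem_ofPred_eq, not_le] at hx ⊢
    rw [norm_smul, Real.norm_of_nonneg (Real.sqrt_nonneg _),
      ← pow_le_pow_iff_left₀ (Real.sqrt_nonneg _) (by positivity) two_ne_zero, mul_pow,
      Real.sq_sqrt hK0.le, Real.sq_sqrt hN'.le, mul_comm]
    exact ((div_lt_iff₀ hN').1 hx).le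
  rw [probReal_compl_eq_one_sub hms] at hcompl
  linarith

end PolyExpFamily

end

open PolyExpFamily in
theorem theorem4p1 :
    ∃ C : ℕ, ∀ (n d : ℕ) [Fact (Odd d)] (B : ℝ), 1 ≤ n → 1 ≤ B →
      ∀ θ ∈ paramBall n d B,
        ((max 2 (n * B)) ^ (C * d ^ 3))⁻¹ ≤ fisherLambdaMin θ ∧
        opNorm (fisherInfo θ)⁻¹ ≤ (max 2 (n * B)) ^ (C * d ^ 3) ∧
        Tendsto (fun N : ℕ => sampleLaw θ N {x | ¬ ∃! θ' : Param n d, IsMaxLik x θ'})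
          atTop (𝓝 0) ∧
        ∀ mle : (N : ℕ) → (Fin N → Fin n → ℝ) → Param n d, (∀ N, IsMLE (mle N)) →
          TendstoInDistribution (fun (N : ℕ) x => √(N : ℝ) • (mle N x - θ)) atTop id
            (sampleLaw θ) (multivariateGaussian 0 (fisherInfo θ)⁻¹) ∧
          ∀ᶠ N : ℕ in atTop,
            0.99 ≤ (sampleLaw θ N).real
              {x | ‖mle N x - θ‖ ^ 2 ≤ (max 2 (n * B)) ^ (C * d ^ 3) / N} := by
  refine ⟨80, fun n d _ B hn hB θ hθ => ?_⟩
  change ((scaleParam n B) ^ (80 * d ^ 3))⁻¹ ≤ fisherLambdaMin θ ∧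
    opNorm (fisherInfo θ)⁻¹ ≤ (scaleParam n B) ^ (80 * d ^ 3) ∧ _ ∧ _
  have hb := two_le_scaleParam n B
  have hpow : scaleParam n B ^ (70 * d ^ 3) ≤ scaleParam n B ^ (80 * d ^ 3) :=
    pow_le_pow_right₀ (by linarith) (by omega)
  have hF := fisherInfo_posDef hn hB hθ
  have hκ : 0 < (scaleParam n B ^ (70 * d ^ 3))⁻¹ := by positivity
  have hQ (h : Param n d) :
      (scaleParam n B ^ (70 * d ^ 3))⁻¹ * ‖h‖ ^ 2 ≤ inner ℝ h (fisherOp θ h) := by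
    rw [inv_mul_le_iff₀ (by positivity)]
    exact norm_sq_le_inner_fisherOp hn hB hθ h
  refine ⟨le_trans (by gcongr) (le_fisherLambdaMin hn hB hθ),
    (opNorm_inv_le hn hB hθ).trans hpow, tendsto_sampleLaw_not_existsUnique hκ hF hQ,
    fun mle hmle => ?_⟩
  have hclt := tendstoInDistribution_mle hκ hF hQ hmle
  exact ⟨hclt, eventually_le_sampleLaw_mle hn hB hθ hmle hclt⟩
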